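/- Let $\beta\in\mathbb R$ and let $(p_k)_{k\ge 1}$ be real numbers with $0\le p_k<\tfrac12$ for all $k\ge 1$ and $$p_k=\frac14\left(\frac1k+\frac1{k(\log\log k)^{\beta}}\right)$$ for all but finitely many $k$. Let $X_0=0,X_1,X_2,\ldots$ be the nearest neighbour random walk on $\{0,1,2,\ldots\}$ determined by $(p_k)$, that is, the Markov chain which from the state $0$ moves to $1$ with probability $1$, and from a state $i\ge 1$ moves to $i+1$ with probability $\tfrac12+p_i$ and to $i-1$ with probability $\tfrac12-p_i$. Call a site $R$ a *cutpoint* if for some $k$ we have $X_k=R$, $X_i\le R$ for all $0\le i\le k$, and $X_i>R$ for all $i>k$; call $R$ a *strong cutpoint* if for some $k$ we have $X_k=R$, $X_i<R$ for all $0\le i<k$, and $X_i>R$ for all $i>k$. If $\beta>1$, then almost surely the walk has only finitely many cutpoints. If $\beta\le 1$, then almost surely the walk has infinitely many strong cutpoints. -/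

import Mathlib

open MeasureTheory Filter

noncomputable section

/-- The probability `E i` of a step from `i` to `i + 1`: it is `1` at the origin and `1/2 + p i` at
`i ≥ 1` (so `p 0` plays no role). -/
def upProb (p : ℕ → ℝ) (i : ℕ) : ℝ :=
  if i = 0 then 1 else 1 / 2 + p i

/-- The transition matrix of the nearest neighbour walk on `{0, 1, 2, …}`: from `i` the walk goes
to `i + 1` with probability `E i` and to `i - 1` with probability `1 - E i`. -/
def transProb (p : ℕ → ℝ) (i j : ℕ) : ℝ :=
  if j = i + 1 then upProb p i else if j + 1 = i then 1 - upProb p i else 0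

/-- `X` is, under `μ`, a Markov chain started at `0` with transition matrix `transProb p`.
The field `markov` says that, conditionally on any history `X 0 = x 0, …, X n = x n` of positive
probability, `X (n + 1) = y` has probability `transProb p (x n) y` (multiplied out, so that
histories of probability zero impose no condition). -/
structure IsNNWalk {Ω : Type*} [MeasurableSpace Ω] (μ : Measure Ω) (p : ℕ → ℝ)
    (X : ℕ → Ω → ℕ) : Prop where
  measurable : ∀ n, Measurable (X n)
  start : ∀ᵐ ω ∂μ, X 0 ω = 0
  markov : ∀ (n : ℕ) (x : ℕ → ℕ) (y : ℕ),
    μ.real {ω | (∀ i ≤ n, X i ω = x i) ∧ X (n + 1) ω = y} =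
      μ.real {ω | ∀ i ≤ n, X i ω = x i} * transProb p (x n) y

/-- The cutpoints of a path `s`: the sites `R` such that for some time `k` the path is at `R` at
time `k`, does not exceed `R` before time `k`, and stays strictly above `R` after time `k`. -/
def cutpoints (s : ℕ → ℕ) : Set ℕ :=
  {R | ∃ k, s k = R ∧ (∀ i ≤ k, s i ≤ R) ∧ ∀ i > k, R < s i}

/-- The strong cutpoints of a path `s`: the sites `R` such that for some time `k` the path is at `R`
at time `k`, strictly below `R` before time `k`, and strictly above `R` after time `k`. -/
def strongCutpoints (s : ℕ → ℕ) : Set ℕ :=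
  {R | ∃ k, s k = R ∧ (∀ i < k, s i < R) ∧ ∀ i > k, R < s i}

end

/-! Write ρ_i for the odds of a step down at i (`oddsDown`). From m + 1 the walk reaches n before m
with probability 1/R(m, n), where R (`resistance`) satisfies R(m, n) = 1 + ρ_{m+1} R(m+1, n). For
g(m) = m (log log m)^β the difference g(m) - ρ_{m+1} g(m+1) tends to 1 (`tendsto_logGauge_sub`), so
by comparison the limit of R(m, n) as n → ∞ is of order g(m), and m is a cutpoint with probability
of order 1/g(m). These probabilities have a divergent sum for every β; what decides is that
cutpoints come in clusters.

Case β > 1. The drift is nonnegative, hence R(m, n+1) ≤ n + 1 - m. The path before the first passage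
to n + 1 is independent of the path after it, so, given that n is the last cutpoint of a dyadic
block, each m ≤ n is a cutpoint with probability at least 1/(n + 1 - m). Summing over m, a block
near 2^k that contains a cutpoint has on average at least order k of them, counted together with the
block below it (`real_biUnion_weakCut_mul_log_le`). The block is therefore hit with probability at
most of order 1/(k (log k)^β), and Borel–Cantelli applies.

Case β ≤ 1. Weighting the site m by 1/log m cancels the cluster size. The weighted mean S is
comparable to the sum of 1/(m log m (log log m)^β), which diverges. Strong cutpoints at i < j have
joint probability at most 1/R(i, j) times that of j. For j < i^2, 1/R(i, j) is at most of order
1/g(i) + 1/(j - i) + 1/i, and the last two terms sum over i to order log j, which the weight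
absorbs; for j ≥ i^2 it is of order 1/g(i). Once S ≥ 1 the second moment is thus at most a constant
times S^2, and strong cutpoints beyond M exist with probability bounded below uniformly in M
(`eventually_le_real_biUnion_strongCut`). Independence across first passages turns this into
probability one (`ae_infinite_strongCutpoints`). -/

/-! ### Path space and its cylinders -/

/-- The paths that agree with `x` up to time `n`. -/
def cyl (n : ℕ) (x : ℕ → ℕ) : Set (ℕ → ℕ) := {y | ∀ i ≤ n, y i = x i}

/-- The path seen from time `n` on. -/
def shift (n : ℕ) (y : ℕ → ℕ) : ℕ → ℕ := fun t => y (n + t)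

/-- The infinite path extending a finite one by zeros. -/
def extendPath {n : ℕ} (l : Fin (n + 1) → ℕ) : ℕ → ℕ :=
  fun i => if h : i < n + 1 then l ⟨i, h⟩ else 0

theorem measurable_shift (n : ℕ) : Measurable (shift n) :=
  measurable_pi_iff.2 fun t => measurable_pi_apply (n + t)

theorem shift_shift (m n : ℕ) (y : ℕ → ℕ) : shift m (shift n y) = shift (n + m) y := by
  funext t; simp [shift, add_assoc]

theorem measurableSet_cyl (n : ℕ) (x : ℕ → ℕ) : MeasurableSet (cyl n x) := by
  have : cyl n x = ⋂ i, ⋂ (_ : i ≤ n), (fun y : ℕ → ℕ => y i) ⁻¹' {x i} := by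
    ext y; simp [cyl]
  rw [this]
  exact MeasurableSet.iInter fun i => MeasurableSet.iInter fun _ =>
    measurable_pi_apply i (measurableSet_singleton _)

theorem mem_cyl_extendPath {n : ℕ} (y : ℕ → ℕ) (l : Fin (n + 1) → ℕ) :
    y ∈ cyl n (extendPath l) ↔ l = fun i : Fin (n + 1) => y i := by
  constructor
  · intro h; funext i
    have := h i (Nat.le_of_lt_succ i.2)
    simpa [extendPath, i.2] using this.symm
  · rintro rfl i hi
    simp [extendPath, Nat.lt_succ_of_le hi]

/-- `S` is determined by the coordinates up to time `n`. -/
def DeterminedBy (n : ℕ) (S : Set (ℕ → ℕ)) : Prop :=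
  ∀ y z : ℕ → ℕ, (∀ i ≤ n, y i = z i) → y ∈ S → z ∈ S

/-- There are only countably many finite histories, so this union is countable: it yields
measurability and reduces the Markov property to cylinders. -/
theorem DeterminedBy.eq_iUnion {n : ℕ} {S : Set (ℕ → ℕ)} (hS : DeterminedBy n S) :
    S = ⋃ l : {l : Fin (n + 1) → ℕ // extendPath l ∈ S}, cyl n (extendPath l.1) := by
  ext y
  simp only [Set.mem_iUnion, mem_cyl_extendPath]
  constructor
  · intro hy
    refine ⟨⟨fun i : Fin (n + 1) => y i, hS _ _ (fun i hi => ?_) hy⟩, rfl⟩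
    simp [extendPath, Nat.lt_succ_of_le hi]
  · rintro ⟨⟨l, hl⟩, rfl⟩
    refine hS _ _ (fun i hi => ?_) hl
    simp [extendPath, Nat.lt_succ_of_le hi]

theorem pairwise_disjoint_cyl (n : ℕ) (P : (Fin (n + 1) → ℕ) → Prop) :
    Pairwise (Function.onFun Disjoint fun l : {l // P l} => cyl n (extendPath l.1)) := by
  intro l l' hll
  rw [Function.onFun, Set.disjoint_left]
  intro y hy hy'
  rw [mem_cyl_extendPath] at hy hy'
  exact hll (Subtype.ext (hy.trans hy'.symm))

theorem DeterminedBy.measurableSet {n : ℕ} {S : Set (ℕ → ℕ)} (hS : DeterminedBy n S) :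
    MeasurableSet S := by
  rw [hS.eq_iUnion]
  exact MeasurableSet.iUnion fun l => measurableSet_cyl _ _

theorem generateFrom_cyl :
    (MeasurableSpace.pi : MeasurableSpace (ℕ → ℕ)) =
      MeasurableSpace.generateFrom {S | S = ∅ ∨ ∃ n x, S = cyl n x} := by
  apply le_antisymm
  · refine iSup_le fun k => ?_
    rw [← measurable_iff_comap_le]
    refine @measurable_to_countable' ℕ (ℕ → ℕ) _ _ (_) _ fun a => ?_
    have h : DeterminedBy k ((fun y : ℕ → ℕ => y k) ⁻¹' {a}) := by
      intro y z hyz hy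
      simpa [← hyz k le_rfl] using hy
    rw [h.eq_iUnion]
    exact MeasurableSet.iUnion fun l =>
      MeasurableSpace.measurableSet_generateFrom (Or.inr ⟨_, _, rfl⟩)
  · refine MeasurableSpace.generateFrom_le ?_
    rintro S (rfl | ⟨n, x, rfl⟩)
    · exact MeasurableSet.empty
    · exact measurableSet_cyl n x

theorem isPiSystem_cyl : IsPiSystem {S : Set (ℕ → ℕ) | S = ∅ ∨ ∃ n x, S = cyl n x} := by
  rintro S (rfl | ⟨n, x, rfl⟩) T (rfl | ⟨m, y, rfl⟩) ⟨z, hz⟩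
  · simp
  · simp
  · simp
  · refine Or.inr ⟨max n m, z, ?_⟩
    ext w
    constructor
    · rintro ⟨h1, h2⟩ i hi
      rcases le_max_iff.1 hi with h | h
      · rw [h1 i h, hz.1 i h]
      · rw [h2 i h, hz.2 i h]
    · intro h
      exact ⟨fun i hi => by rw [h i (le_max_of_le_left hi), hz.1 i hi],
        fun i hi => by rw [h i (le_max_of_le_right hi), hz.2 i hi]⟩

/-- Finite measures on path space are determined by the cylinders. -/
theorem ext_of_cyl {μ ν : Measure (ℕ → ℕ)} [IsFiniteMeasure μ] [IsFiniteMeasure ν]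
    (h : ∀ n x, μ (cyl n x) = ν (cyl n x)) : μ = ν := by
  have h0 : ∀ m : Measure (ℕ → ℕ),
      m Set.univ = ∑' l : {l : Fin (0 + 1) → ℕ // extendPath l ∈ (Set.univ : Set (ℕ → ℕ))},
        m (cyl 0 (extendPath l.1)) := by
    intro m
    have hd : DeterminedBy 0 (Set.univ : Set (ℕ → ℕ)) := fun _ _ _ _ => trivial
    conv_lhs => rw [hd.eq_iUnion]
    exact measure_iUnion (pairwise_disjoint_cyl 0 _) fun l => measurableSet_cyl _ _
  refine ext_of_generate_finite _ generateFrom_cyl isPiSystem_cyl ?_ ?_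
  · rintro S (rfl | ⟨n, x, rfl⟩)
    · simp
    · exact h n x
  · rw [h0, h0]
    exact tsum_congr fun l => h _ _

/-! ### Laws of the walk and the Markov property -/

/-- The probability of the first `n` steps of `x`. -/
noncomputable def pathProb (p : ℕ → ℝ) (n : ℕ) (x : ℕ → ℕ) : ℝ :=
  ∏ j ∈ Finset.range n, transProb p (x j) (x (j + 1))

/-- `Q i` is the law of the walk started at `i`, for every `i`. -/
structure IsWalkFamily (p : ℕ → ℝ) (Q : ℕ → Measure (ℕ → ℕ)) : Prop where
  prob : ∀ i, IsProbabilityMeasure (Q i)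
  real_cyl : ∀ i n x, (Q i).real (cyl n x) = if x 0 = i then pathProb p n x else 0

/-- The path that follows `x` up to time `n` and then `z`. -/
def glue (n : ℕ) (x z : ℕ → ℕ) : ℕ → ℕ := fun i => if i ≤ n then x i else z (i - n)

theorem cyl_inter_shift {n k : ℕ} {x z : ℕ → ℕ} (h : z 0 = x n) :
    cyl n x ∩ shift n ⁻¹' cyl k z = cyl (n + k) (glue n x z) := by
  ext y
  constructor
  · rintro ⟨h1, h2⟩ i hi
    rw [glue]
    split_ifs with hin
    · exact h1 i hin
    · have := h2 (i - n) (by omega)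
      simpa [shift, Nat.add_sub_cancel' (le_of_not_ge hin)] using this
  · intro hy
    constructor
    · intro i hi
      rw [hy i (by omega), glue, if_pos hi]
    · intro i hi
      rw [shift, hy (n + i) (by omega), glue]
      split_ifs with hin
      · obtain rfl : i = 0 := by omega
        simp [h]
      · simp

theorem cyl_inter_shift_of_ne {n k : ℕ} {x z : ℕ → ℕ} (h : z 0 ≠ x n) :
    cyl n x ∩ shift n ⁻¹' cyl k z = ∅ := by
  ext y
  simp only [Set.mem_inter_iff, Set.mem_preimage, Set.mem_empty_iff_false, iff_false, not_and]
  intro h1 h2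
  apply h
  have := h2 0 (Nat.zero_le _)
  rw [← this, ← h1 n le_rfl]
  simp [shift]

theorem pathProb_glue (p : ℕ → ℝ) {n k : ℕ} {x z : ℕ → ℕ} (h : z 0 = x n) :
    pathProb p (n + k) (glue n x z) = pathProb p n x * pathProb p k z := by
  rw [pathProb, Finset.prod_range_add]
  congr 1
  · refine Finset.prod_congr rfl fun j hj => ?_
    have := Finset.mem_range.1 hj
    rw [glue, glue, if_pos (by omega), if_pos (by omega)]
  · refine Finset.prod_congr rfl fun j hj => ?_
    have h1 : glue n x z (n + j) = z j := by
      rw [glue]; split_ifs with hh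
      · obtain rfl : j = 0 := by omega
        simp [h]
      · simp
    have h2 : glue n x z (n + j + 1) = z (j + 1) := by
      rw [glue, if_neg (by omega)]; congr 1; omega
    rw [h1, h2]

namespace IsWalkFamily

variable {p : ℕ → ℝ} {Q : ℕ → Measure (ℕ → ℕ)}

/-- The Markov property at time `n`, for a full history. -/
theorem markov_cyl (hQ : IsWalkFamily p Q) (i n : ℕ) (x : ℕ → ℕ) {E : Set (ℕ → ℕ)}
    (hE : MeasurableSet E) :
    Q i (cyl n x ∩ shift n ⁻¹' E) = Q i (cyl n x) * Q (x n) E := by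
  have := hQ.prob
  have key : ((Q i).restrict (cyl n x)).map (shift n) = Q i (cyl n x) • Q (x n) := by
    have hf : IsFiniteMeasure (Q i (cyl n x) • Q (x n)) :=
      Measure.smul_finite _ (measure_ne_top _ _)
    refine ext_of_cyl fun k z => ?_
    rw [Measure.map_apply (measurable_shift n) (measurableSet_cyl _ _),
      Measure.restrict_apply (measurable_shift n (measurableSet_cyl _ _)), Measure.smul_apply,
      smul_eq_mul, Set.inter_comm]
    rw [← ENNReal.toReal_eq_toReal_iff' (measure_ne_top _ _)
      (ENNReal.mul_ne_top (measure_ne_top _ _) (measure_ne_top _ _)), ENNReal.toReal_mul]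
    change (Q i).real _ = (Q i).real _ * (Q (x n)).real _
    by_cases h : z 0 = x n
    · rw [cyl_inter_shift h, hQ.real_cyl, hQ.real_cyl, hQ.real_cyl, if_pos h, pathProb_glue p h]
      have : glue n x z 0 = x 0 := by simp [glue]
      rw [this]; split_ifs <;> simp
    · rw [cyl_inter_shift_of_ne h, hQ.real_cyl (x n), if_neg h]; simp
  have h2 := congrArg (fun m : Measure (ℕ → ℕ) => m E) key
  rw [Measure.map_apply (measurable_shift n) hE,
    Measure.restrict_apply (measurable_shift n hE), Measure.smul_apply, smul_eq_mul,
    Set.inter_comm] at h2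
  exact h2

/-- The Markov property at time `n`, for an event of the past that pins the state at time `n`. -/
theorem markov (hQ : IsWalkFamily p Q) (i : ℕ) {n a : ℕ} {S : Set (ℕ → ℕ)}
    (hS : DeterminedBy n S) (ha : ∀ y ∈ S, y n = a) {E : Set (ℕ → ℕ)} (hE : MeasurableSet E) :
    Q i (S ∩ shift n ⁻¹' E) = Q i S * Q a E := by
  conv_lhs => rw [hS.eq_iUnion, Set.iUnion_inter]
  conv_rhs => rw [hS.eq_iUnion]
  rw [measure_iUnion (pairwise_disjoint_cyl n _) (fun l => measurableSet_cyl _ _),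
    measure_iUnion, ← ENNReal.tsum_mul_right]
  · refine tsum_congr fun l => ?_
    rw [hQ.markov_cyl i n _ hE, ha _ l.2]
  · intro l l' hll
    exact (pairwise_disjoint_cyl n _ hll).mono Set.inter_subset_left Set.inter_subset_left
  · exact fun l => (measurableSet_cyl _ _).inter (measurable_shift n hE)

theorem real_start (hQ : IsWalkFamily p Q) (i : ℕ) : (Q i).real {y | y 0 = i} = 1 := by
  have h := hQ.real_cyl i 0 fun _ => i
  simp only [pathProb, Finset.range_zero, Finset.prod_empty, if_true] at h
  rw [← h]; congr 1; ext y; simp [cyl]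

theorem ae_start (hQ : IsWalkFamily p Q) (i : ℕ) : ∀ᵐ y ∂Q i, y 0 = i := by
  have := hQ.prob i
  have hm : MeasurableSet {y : ℕ → ℕ | y 0 = i} :=
    measurableSet_eq_fun (measurable_pi_apply 0) measurable_const
  rw [ae_iff_measure_eq hm.nullMeasurableSet, measure_univ]
  have h := hQ.real_start i
  rw [measureReal_def] at h
  exact (ENNReal.toReal_eq_one_iff _).1 h

/-- Conditioning on the first step. -/
theorem real_shift_one (hQ : IsWalkFamily p Q) (i : ℕ) {E : Set (ℕ → ℕ)}
    (hE : MeasurableSet E) :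
    (Q i).real (shift 1 ⁻¹' E) =
      upProb p i * (Q (i + 1)).real E + (1 - upProb p i) * (Q (i - 1)).real E := by
  have := hQ.prob
  set S : Set (ℕ → ℕ) := {y | y 0 = i ∧ y 1 = i + 1} with hS
  set T : Set (ℕ → ℕ) := {y | y 0 = i ∧ y 1 + 1 = i} with hT
  have dS : DeterminedBy 1 S := fun y z h hy => by
    simpa [hS, ← h 0 (by omega), ← h 1 le_rfl] using hy
  have dT : DeterminedBy 1 T := fun y z h hy => by
    simpa [hT, ← h 0 (by omega), ← h 1 le_rfl] using hy
  have two : ∀ y x : ℕ → ℕ, y ∈ cyl 1 x ↔ y 0 = x 0 ∧ y 1 = x 1 := by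
    intro y x
    refine ⟨fun h => ⟨h 0 (by omega), h 1 le_rfl⟩, fun h j hj => ?_⟩
    interval_cases j
    exacts [h.1, h.2]
  have pS : (Q i).real S = upProb p i := by
    have h := hQ.real_cyl i 1 fun t => i + t
    rw [if_pos (by simp)] at h
    have e : cyl 1 (fun t => i + t) = S := by ext y; simp [two, hS]
    rw [e] at h
    rw [h]; simp [pathProb, transProb]
  have pT : (Q i).real T = 1 - upProb p i := by
    -- At the origin the step down has probability zero, so the truncated value i - 1 = 0 is
    -- harmless.
    rcases Nat.eq_zero_or_pos i with h0 | h0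
    · have e : T = ∅ := by ext y; simp [hT, h0]
      rw [e]; simp [h0, upProb]
    · have h := hQ.real_cyl i 1 fun t => i - t
      rw [if_pos (by simp)] at h
      have e : cyl 1 (fun t => i - t) = T := by
        ext y; simp only [two, hT, Set.mem_ofPred_eq]; omega
      rw [e] at h
      rw [h]
      have h1 : ¬ (i - 1 = i + 1) := by omega
      have h2 : i - 1 + 1 = i := by omega
      simp [pathProb, transProb, h1, h2]
  have disj : Disjoint S T := by
    rw [Set.disjoint_left]; rintro y ⟨_, h1⟩ ⟨_, h2⟩; omega
  have full : (Q i) (S ∪ T)ᶜ = 0 := by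
    rw [← measureReal_eq_zero_iff, measureReal_compl (dS.measurableSet.union dT.measurableSet),
      measureReal_union disj dT.measurableSet, pS, pT]
    simp
  have mS : (Q i).real (S ∩ shift 1 ⁻¹' E) = upProb p i * (Q (i + 1)).real E := by
    rw [measureReal_def, hQ.markov i dS (fun y hy => hy.2) hE, ENNReal.toReal_mul, ← pS]; rfl
  have mT : (Q i).real (T ∩ shift 1 ⁻¹' E) = (1 - upProb p i) * (Q (i - 1)).real E := by
    rw [measureReal_def, hQ.markov (a := i - 1) i dT (fun y hy => by have := hy.2; omega) hE,
      ENNReal.toReal_mul, ← pT]; rfl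
  rw [← mS, ← mT, ← measureReal_union (disj.mono Set.inter_subset_left Set.inter_subset_left)
    (dT.measurableSet.inter (measurable_shift 1 hE)), ← Set.union_inter_distrib_right]
  refine measureReal_congr ?_
  filter_upwards [measure_eq_zero_iff_ae_notMem.1 full] with y hy
  apply propext
  change y ∈ shift 1 ⁻¹' E ↔ y ∈ S ∪ T ∧ y ∈ shift 1 ⁻¹' E
  simp only [Set.mem_compl_iff, not_not] at hy
  exact ⟨fun h => ⟨hy, h⟩, fun h => h.2⟩

end IsWalkFamily

/-! ### First passages and the strong Markov property -/

/-- `k` is the time of the first visit of `s` to `n`, and `s` is below `n` before. -/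
def FirstPassage (s : ℕ → ℕ) (n k : ℕ) : Prop := s k = n ∧ ∀ i < k, s i < n

theorem FirstPassage.unique {s : ℕ → ℕ} {n k l : ℕ} (h : FirstPassage s n k)
    (h' : FirstPassage s n l) : k = l := by
  rcases lt_trichotomy k l with hh | hh | hh
  · exact absurd h.1 (h'.2 k hh).ne
  · exact hh
  · exact absurd h'.1 (h.2 l hh).ne

theorem FirstPassage.mono {s : ℕ → ℕ} {m n k l : ℕ} (hmn : m ≤ n) (h : FirstPassage s m k)
    (h' : FirstPassage s n l) : k ≤ l := by
  by_contra hlt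
  have := h.2 l (by omega)
  rw [h'.1] at this
  omega

theorem FirstPassage.congr {s s' : ℕ → ℕ} {n k : ℕ} (hs : ∀ i ≤ k, s i = s' i)
    (h : FirstPassage s n k) : FirstPassage s' n k :=
  ⟨by rw [← hs k le_rfl, h.1], fun i hi => by rw [← hs i hi.le]; exact h.2 i hi⟩

theorem FirstPassage.shift_iff {s : ℕ → ℕ} {m n k : ℕ} (hmn : m ≤ n) (h : FirstPassage s m k)
    (l : ℕ) : FirstPassage (shift k s) n l ↔ FirstPassage s n (k + l) := by
  constructor
  · rintro ⟨h1, h2⟩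
    refine ⟨h1, fun i hi => ?_⟩
    rcases lt_or_ge i k with hik | hik
    · exact (h.2 i hik).trans_le hmn
    · have := h2 (i - k) (by omega)
      rwa [shift, Nat.add_sub_cancel' hik] at this
  · rintro ⟨h1, h2⟩
    exact ⟨h1, fun i hi => h2 (k + i) (by omega)⟩

/-- The paths whose part from the first passage to `n` on lies in `E`. -/
def future (n : ℕ) (E : Set (ℕ → ℕ)) : Set (ℕ → ℕ) := {s | ∃ k, FirstPassage s n k ∧ shift k s ∈ E}

theorem FirstPassage.mem_future {s : ℕ → ℕ} {n k : ℕ} (h : FirstPassage s n k)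
    (E : Set (ℕ → ℕ)) : s ∈ future n E ↔ shift k s ∈ E :=
  ⟨fun ⟨l, hl, hE⟩ => by rwa [h.unique hl], fun hE => ⟨k, h, hE⟩⟩

/-- Before its first passage to m the path is below m, so dropping that part only translates the
first passages to higher levels. Events about levels from m on can thus be read off after that
passage. -/
theorem FirstPassage.shift_mem_future {s : ℕ → ℕ} {m n k : ℕ} (hmn : m ≤ n)
    (h : FirstPassage s m k) (E : Set (ℕ → ℕ)) : shift k s ∈ future n E ↔ s ∈ future n E := by
  constructor
  · rintro ⟨l, hl, hE⟩
    exact ⟨k + l, (h.shift_iff hmn l).1 hl, by rwa [shift_shift] at hE⟩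
  · rintro ⟨l, hl, hE⟩
    obtain ⟨j, rfl⟩ := Nat.exists_eq_add_of_le (h.mono hmn hl)
    exact ⟨j, (h.shift_iff hmn j).2 hl, by rwa [shift_shift]⟩

/-- `S` is determined by the path up to its first passage to `n`. -/
def PriorTo (n : ℕ) (S : Set (ℕ → ℕ)) : Prop :=
  ∀ s s' k, FirstPassage s n k → (∀ i ≤ k, s i = s' i) → s ∈ S → s' ∈ S

/-- `PriorTo` constrains only paths that reach n, so S itself need not be measurable; its trace on
each value of the first passage time is. -/
theorem PriorTo.determinedBy {n : ℕ} {S : Set (ℕ → ℕ)} (hS : PriorTo n S) (k : ℕ) :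
    DeterminedBy k (S ∩ {s | FirstPassage s n k}) := fun _ _ hs h =>
  ⟨hS _ _ k h.2 hs h.1, h.2.congr hs⟩

theorem priorTo_univ (n : ℕ) : PriorTo n Set.univ := fun _ _ _ _ _ _ => trivial

theorem PriorTo.compl {n : ℕ} {S : Set (ℕ → ℕ)} (hS : PriorTo n S) : PriorTo n Sᶜ :=
  fun _ _ k h hs hn hs' => hn (hS _ _ k (h.congr hs) (fun i hi => (hs i hi).symm) hs')

theorem measurableSet_firstPassage (n k : ℕ) : MeasurableSet {s | FirstPassage s n k} := by
  have := ((priorTo_univ n).determinedBy k).measurableSet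
  rwa [Set.univ_inter] at this

theorem future_eq_iUnion (n : ℕ) (E : Set (ℕ → ℕ)) :
    future n E = ⋃ k, {s | FirstPassage s n k} ∩ shift k ⁻¹' E := by
  ext s; simp [future]

theorem measurableSet_future (n : ℕ) {E : Set (ℕ → ℕ)} (hE : MeasurableSet E) :
    MeasurableSet (future n E) := by
  rw [future_eq_iUnion]
  exact MeasurableSet.iUnion fun k =>
    (measurableSet_firstPassage n k).inter (measurable_shift k hE)

/-- The strong Markov property at the first passage to `n`. -/
theorem IsWalkFamily.strong_markov {p : ℕ → ℝ} {Q : ℕ → Measure (ℕ → ℕ)}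
    (hQ : IsWalkFamily p Q) (i : ℕ) {n : ℕ} {S : Set (ℕ → ℕ)} (hS : PriorTo n S)
    {E : Set (ℕ → ℕ)} (hE : MeasurableSet E) :
    Q i (S ∩ future n E) = Q i (S ∩ future n Set.univ) * Q n E := by
  have decomp : ∀ E : Set (ℕ → ℕ), MeasurableSet E →
      Q i (S ∩ future n E) = ∑' k, Q i ((S ∩ {s | FirstPassage s n k}) ∩ shift k ⁻¹' E) := by
    intro E hE
    rw [future_eq_iUnion, Set.inter_iUnion, ← measure_iUnion]
    · simp only [Set.inter_assoc]
    · intro k l hkl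
      rw [Function.onFun, Set.disjoint_left]
      rintro s ⟨⟨_, h⟩, _⟩ ⟨⟨_, h'⟩, _⟩
      exact hkl (h.unique h')
    · exact fun k => ((hS.determinedBy k).measurableSet).inter (measurable_shift k hE)
  rw [decomp E hE, decomp _ MeasurableSet.univ, ← ENNReal.tsum_mul_right]
  refine tsum_congr fun k => ?_
  rw [hQ.markov i (hS.determinedBy k) (fun y hy => hy.2.1) hE, Set.preimage_univ, Set.inter_univ]

/-! ### Existence of the laws from all starting points -/

theorem upProb_pos {p : ℕ → ℝ} (hp : ∀ k : ℕ, 1 ≤ k → 0 ≤ p k ∧ p k < 1 / 2) (i : ℕ) :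
    0 < upProb p i := by
  unfold upProb
  split_ifs with h
  · norm_num
  · linarith [(hp i (Nat.one_le_iff_ne_zero.2 h)).1]

theorem upProb_le_one {p : ℕ → ℝ} (hp : ∀ k : ℕ, 1 ≤ k → 0 ≤ p k ∧ p k < 1 / 2) (i : ℕ) :
    upProb p i ≤ 1 := by
  unfold upProb
  split_ifs with h
  · exact le_rfl
  · linarith [(hp i (Nat.one_le_iff_ne_zero.2 h)).2]

/-- `id` is the straight ascent 0, 1, 2, …; positivity permits conditioning on it in
`IsNNWalk.exists_isWalkFamily`. -/
theorem pathProb_id_pos {p : ℕ → ℝ} (hp : ∀ k : ℕ, 1 ≤ k → 0 ≤ p k ∧ p k < 1 / 2) (n : ℕ) :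
    0 < pathProb p n id :=
  Finset.prod_pos fun j _ => by simpa [transProb] using upProb_pos hp j

theorem IsNNWalk.real_history {Ω : Type*} [MeasurableSpace Ω] {μ : Measure Ω}
    [IsProbabilityMeasure μ] {p : ℕ → ℝ} {X : ℕ → Ω → ℕ} (hX : IsNNWalk μ p X) (n : ℕ)
    (x : ℕ → ℕ) :
    μ.real {ω | ∀ i ≤ n, X i ω = x i} = if x 0 = 0 then pathProb p n x else 0 := by
  induction n with
  | zero =>
    split_ifs with h
    · have : {ω | ∀ i ≤ 0, X i ω = x i} =ᵐ[μ] Set.univ := by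
        filter_upwards [hX.start] with ω hω
        apply propext
        change (∀ i ≤ 0, X i ω = x i) ↔ True
        simp [h, hω]
      rw [measureReal_congr this]; simp [pathProb]
    · rw [measureReal_eq_zero_iff, measure_eq_zero_iff_ae_notMem]
      filter_upwards [hX.start] with ω hω hh
      have := hh 0 le_rfl
      exact h (by rw [← this, hω])
  | succ n ih =>
    have e : {ω | ∀ i ≤ n + 1, X i ω = x i} =
        {ω | (∀ i ≤ n, X i ω = x i) ∧ X (n + 1) ω = x (n + 1)} := by
      ext ω
      constructor
      · exact fun h => ⟨fun i hi => h i (by omega), h _ le_rfl⟩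
      · rintro ⟨h1, h2⟩ i hi
        rcases Nat.lt_or_ge n i with h | h
        · obtain rfl : i = n + 1 := by omega
          exact h2
        · exact h1 i h
    rw [e, hX.markov, ih, pathProb, pathProb, Finset.prod_range_succ]
    split_ifs <;> simp

/-- The laws of the walk from all starting points, obtained from the walk started at the origin by
conditioning on a straight ascent. -/
theorem IsNNWalk.exists_isWalkFamily {Ω : Type*} [MeasurableSpace Ω] {μ : Measure Ω}
    [IsProbabilityMeasure μ] {p : ℕ → ℝ} (hp : ∀ k : ℕ, 1 ≤ k → 0 ≤ p k ∧ p k < 1 / 2)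
    {X : ℕ → Ω → ℕ} (hX : IsNNWalk μ p X) :
    ∃ Q, IsWalkFamily p Q ∧ Q 0 = μ.map fun ω n => X n ω := by
  have hm : Measurable fun ω n => X n ω := measurable_pi_iff.2 hX.measurable
  set ν := μ.map fun ω n => X n ω with hν
  have : IsProbabilityMeasure ν := Measure.isProbabilityMeasure_map hm.aemeasurable
  have hcyl : ∀ n x, ν.real (cyl n x) = if x 0 = 0 then pathProb p n x else 0 := by
    intro n x
    rw [hν, map_measureReal_apply hm (measurableSet_cyl n x)]
    exact hX.real_history n x
  have hpos : ∀ i, 0 < ν.real (cyl i id) := by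
    intro i; rw [hcyl, if_pos (show id 0 = 0 from rfl)]; exact pathProb_id_pos hp i
  have hne : ∀ i, ν (cyl i id) ≠ 0 := fun i h => by
    have := hpos i
    rw [measureReal_def, h] at this
    simp at this
  refine ⟨fun i => (ProbabilityTheory.cond ν (cyl i id)).map (shift i), ⟨fun i => ?_, ?_⟩, ?_⟩
  · have := ProbabilityTheory.cond_isProbabilityMeasure (hne i)
    exact Measure.isProbabilityMeasure_map (measurable_shift i).aemeasurable
  · intro i n x
    rw [map_measureReal_apply (measurable_shift i) (measurableSet_cyl n x),
      measureReal_def, ProbabilityTheory.cond_apply (measurableSet_cyl i id), ENNReal.toReal_mul,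
      ENNReal.toReal_inv]
    change (ν.real _)⁻¹ * ν.real _ = _
    split_ifs with h
    · rw [cyl_inter_shift (by simpa using h), hcyl, hcyl, if_pos (show id 0 = 0 from rfl), if_pos (by simp [glue]),
        pathProb_glue p (by simpa using h)]
      have := (pathProb_id_pos hp i).ne'
      field_simp
    · rw [cyl_inter_shift_of_ne (by simpa using h)]; simp
  -- For i = 0 the conditioning is on starting at the origin, which is almost sure and changes
  -- nothing.
  · have h1 : ν (cyl 0 id)ᶜ = 0 := by
      rw [← measureReal_eq_zero_iff, measureReal_compl (measurableSet_cyl 0 id), hcyl]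
      simp [pathProb]
    have h2 : ν (cyl 0 id) = 1 := by
      rwa [prob_compl_eq_zero_iff (measurableSet_cyl 0 id)] at h1
    have h3 : shift 0 = id := by funext y t; simp [shift]
    simp only [h3, Measure.map_id]
    rw [ProbabilityTheory.cond, h2, inv_one, one_smul, Measure.restrict_eq_self_of_ae_mem]
    exact measure_eq_zero_iff_ae_notMem.1 h1 |>.mono fun y hy => by simpa using hy

/-! ### Resistances and escape probabilities -/

/-- The odds ratio of a step down to a step up. -/
noncomputable def oddsDown (p : ℕ → ℝ) (i : ℕ) : ℝ := (1 - upProb p i) / upProb p i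

/-- The reciprocal of the probability to reach `n` from `m + 1` without visiting `m`. -/
noncomputable def resistance (p : ℕ → ℝ) (m n : ℕ) : ℝ :=
  ∑ j ∈ Finset.Ico m n, ∏ i ∈ Finset.Ioc m j, oddsDown p i

/-- A function that is harmonic strictly between `m` and `n` is determined by its increment at
`m`. -/
theorem harmonic_sub_eq {p : ℕ → ℝ} (hp : ∀ k : ℕ, 1 ≤ k → 0 ≤ p k ∧ p k < 1 / 2) {h : ℕ → ℝ}
    {m n : ℕ} (hh : ∀ i, m < i → i < n →
      h i = upProb p i * h (i + 1) + (1 - upProb p i) * h (i - 1)) {k : ℕ} (hmk : m ≤ k)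
    (hkn : k ≤ n) : h k - h m = (h (m + 1) - h m) * resistance p m k := by
  -- Harmonicity at j + 1 balances the two adjacent increments: the upper one is the lower one times
  -- `oddsDown p (j + 1)`.
  have hd : ∀ j, m ≤ j → j < n →
      h (j + 1) - h j = (h (m + 1) - h m) * ∏ i ∈ Finset.Ioc m j, oddsDown p i := by
    intro j hj
    induction j, hj using Nat.le_induction with
    | base => simp
    | succ j hj ih =>
      intro hjn
      have h1 := ih (by omega)
      have h2 := hh (j + 1) (by omega) hjn
      rw [Finset.prod_Ioc_succ_top (by omega), ← mul_assoc, ← h1, oddsDown]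
      have := (upProb_pos hp (j + 1)).ne'
      field_simp
      simp only [Nat.add_sub_cancel] at h2
      linear_combination -h2
  have e : ∑ j ∈ Finset.Ico m k, (h (j + 1) - h j) = h k - h m := Finset.sum_Ico_sub h hmk
  rw [← e, resistance, Finset.mul_sum]
  refine Finset.sum_congr rfl fun j hj => ?_
  rw [Finset.mem_Ico] at hj
  exact hd j hj.1 (by omega)

theorem oddsDown_mem {p : ℕ → ℝ} (hp : ∀ k : ℕ, 1 ≤ k → 0 ≤ p k ∧ p k < 1 / 2) {i : ℕ}
    (hi : 1 ≤ i) : 0 < oddsDown p i ∧ oddsDown p i ≤ 1 := by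
  have h := hp i hi
  have h1 : upProb p i = 1 / 2 + p i := by simp [upProb, Nat.one_le_iff_ne_zero.1 hi]
  rw [oddsDown, h1]
  constructor
  · exact div_pos (by linarith) (by linarith)
  · rw [div_le_one (by linarith)]; linarith

theorem prod_oddsDown_pos {p : ℕ → ℝ} (hp : ∀ k : ℕ, 1 ≤ k → 0 ≤ p k ∧ p k < 1 / 2) (m j : ℕ) :
    0 < ∏ i ∈ Finset.Ioc m j, oddsDown p i :=
  Finset.prod_pos fun i hi => (oddsDown_mem hp (by rw [Finset.mem_Ioc] at hi; omega)).1

theorem prod_oddsDown_le_one {p : ℕ → ℝ} (hp : ∀ k : ℕ, 1 ≤ k → 0 ≤ p k ∧ p k < 1 / 2)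
    (m j : ℕ) : ∏ i ∈ Finset.Ioc m j, oddsDown p i ≤ 1 :=
  Finset.prod_le_one
    (fun i hi => (oddsDown_mem hp (by rw [Finset.mem_Ioc] at hi; omega)).1.le)
    fun i hi => (oddsDown_mem hp (by rw [Finset.mem_Ioc] at hi; omega)).2

/-- Nonnegative drift makes all odds at most 1, so every summand is at most its value for the simple
random walk. This is the source of clustering. -/
theorem resistance_le_sub {p : ℕ → ℝ} (hp : ∀ k : ℕ, 1 ≤ k → 0 ≤ p k ∧ p k < 1 / 2) {m n : ℕ}
    (hmn : m ≤ n) : resistance p m n ≤ n - m := by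
  have := Finset.sum_le_card_nsmul (Finset.Ico m n)
    (fun j => ∏ i ∈ Finset.Ioc m j, oddsDown p i) 1 fun j _ => prod_oddsDown_le_one hp m j
  rw [resistance]
  simpa [Nat.cast_sub hmn] using this

theorem resistance_mono {p : ℕ → ℝ} (hp : ∀ k : ℕ, 1 ≤ k → 0 ≤ p k ∧ p k < 1 / 2) (m : ℕ) :
    Monotone (resistance p m) := fun _ _ hab =>
  Finset.sum_le_sum_of_subset_of_nonneg (Finset.Ico_subset_Ico_right hab)
    fun j _ _ => (prod_oddsDown_pos hp m j).le

theorem one_le_resistance {p : ℕ → ℝ} (hp : ∀ k : ℕ, 1 ≤ k → 0 ≤ p k ∧ p k < 1 / 2) {m n : ℕ}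
    (hmn : m < n) : 1 ≤ resistance p m n := by
  have h : resistance p m (m + 1) = 1 := by simp [resistance]
  rw [← h]
  exact resistance_mono hp m hmn

/-- The paths that climb to `n` while staying above `m`. -/
def climbAbove (m n : ℕ) : Set (ℕ → ℕ) := {y | ∃ l, FirstPassage y n l ∧ ∀ i ≤ l, m < y i}

/-- The paths that stay above `m` forever. -/
def stayAbove (m : ℕ) : Set (ℕ → ℕ) := {y | ∀ i, m < y i}

theorem measurableSet_climbAbove (m n : ℕ) : MeasurableSet (climbAbove m n) := by
  have e : climbAbove m n = ⋃ l, {y | FirstPassage y n l ∧ ∀ i ≤ l, m < y i} := by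
    ext y; simp [climbAbove]
  rw [e]
  refine MeasurableSet.iUnion fun l => DeterminedBy.measurableSet (n := l) ?_
  rintro y z hyz ⟨h1, h2⟩
  exact ⟨h1.congr hyz, fun i hi => by rw [← hyz i hi]; exact h2 i hi⟩

theorem measurableSet_stayAbove (m : ℕ) : MeasurableSet (stayAbove m) := by
  have e : stayAbove m = ⋂ i, {y | m < y i} := by ext y; simp [stayAbove]
  rw [e]
  exact MeasurableSet.iInter fun i => measurableSet_lt measurable_const (measurable_pi_apply i)

theorem shift_one_firstPassage {y : ℕ → ℕ} {n : ℕ} (h0 : y 0 < n) (l : ℕ) :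
    FirstPassage (shift 1 y) n l ↔ FirstPassage y n (l + 1) := by
  constructor
  · rintro ⟨h1, h2⟩
    refine ⟨by rw [← h1, shift, add_comm], fun i hi => ?_⟩
    rcases i with _ | i
    · exact h0
    · have := h2 i (by omega)
      rwa [shift, add_comm] at this
  · rintro ⟨h1, h2⟩
    exact ⟨by rw [← h1, shift, add_comm], fun i hi => h2 (1 + i) (by omega)⟩

theorem shift_one_mem_future {y : ℕ → ℕ} {n : ℕ} (h0 : y 0 < n) :
    shift 1 y ∈ future n Set.univ ↔ y ∈ future n Set.univ := by
  constructor
  · rintro ⟨l, hl, _⟩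
    exact ⟨l + 1, (shift_one_firstPassage h0 l).1 hl, trivial⟩
  · rintro ⟨l, hl, _⟩
    rcases l with _ | l
    · exact absurd hl.1 h0.ne
    · exact ⟨l, (shift_one_firstPassage h0 l).2 hl, trivial⟩

theorem shift_one_mem_climbAbove {y : ℕ → ℕ} {m n : ℕ} (h0 : y 0 < n) (hm : m < y 0) :
    shift 1 y ∈ climbAbove m n ↔ y ∈ climbAbove m n := by
  constructor
  · rintro ⟨l, hl, h⟩
    refine ⟨l + 1, (shift_one_firstPassage h0 l).1 hl, fun i hi => ?_⟩
    rcases i with _ | i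
    · exact hm
    · have := h i (by omega)
      rwa [shift, add_comm] at this
  · rintro ⟨l, hl, h⟩
    rcases l with _ | l
    · exact absurd hl.1 h0.ne
    · exact ⟨l, (shift_one_firstPassage h0 l).2 hl, fun i hi => h (1 + i) (by omega)⟩

namespace IsWalkFamily

variable {p : ℕ → ℝ} {Q : ℕ → Measure (ℕ → ℕ)}

theorem real_eq_of_ae_shift_one (hQ : IsWalkFamily p Q) (i : ℕ) {E : Set (ℕ → ℕ)}
    (hE : MeasurableSet E) (h : ∀ y : ℕ → ℕ, y 0 = i → (shift 1 y ∈ E ↔ y ∈ E)) :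
    (Q i).real E = upProb p i * (Q (i + 1)).real E + (1 - upProb p i) * (Q (i - 1)).real E := by
  rw [← hQ.real_shift_one i hE]
  refine measureReal_congr ?_
  filter_upwards [hQ.ae_start i] with y hy
  exact propext (h y hy).symm

/-- The hitting probability is harmonic below n. The origin reflects, so its increment there
vanishes; it is then constant up to n, where it equals 1. -/
theorem real_future_univ (hQ : IsWalkFamily p Q)
    (hp : ∀ k : ℕ, 1 ≤ k → 0 ≤ p k ∧ p k < 1 / 2) {i n : ℕ} (hin : i ≤ n) :
    (Q i).real (future n Set.univ) = 1 := by
  have := hQ.prob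
  set h : ℕ → ℝ := fun i => (Q i).real (future n Set.univ) with hh
  have hn : h n = 1 := by
    have : Set.univ =ᵐ[Q n] future n Set.univ := by
      filter_upwards [hQ.ae_start n] with y hy
      refine propext ⟨fun _ => ⟨0, ⟨hy, by simp⟩, trivial⟩, fun _ => trivial⟩
    simp only [hh]
    rw [← measureReal_congr this]; simp
  have harm : ∀ i < n, h i = upProb p i * h (i + 1) + (1 - upProb p i) * h (i - 1) :=
    fun i hi => hQ.real_eq_of_ae_shift_one i (measurableSet_future n MeasurableSet.univ)
      fun y hy => shift_one_mem_future (by omega)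
  rcases Nat.eq_zero_or_pos n with h0 | h0
  · obtain rfl : i = n := by omega
    exact hn
  · have h01 : h (0 + 1) - h 0 = 0 := by
      have := harm 0 h0
      simp [upProb] at this
      simp [this]
    have key := fun k (hk : k ≤ n) =>
      harmonic_sub_eq hp (h := h) (m := 0) (fun i _ hi => harm i hi) (Nat.zero_le k) hk
    have h1 := key i hin
    have h2 := key n le_rfl
    rw [h01, zero_mul] at h1 h2
    change h i = 1
    linarith

theorem ae_future_univ (hQ : IsWalkFamily p Q)
    (hp : ∀ k : ℕ, 1 ≤ k → 0 ≤ p k ∧ p k < 1 / 2) {i n : ℕ} (hin : i ≤ n) :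
    ∀ᵐ y ∂Q i, y ∈ future n Set.univ := by
  have := hQ.prob i
  have h := hQ.real_future_univ hp hin
  rw [measureReal_def] at h
  have h1 := (ENNReal.toReal_eq_one_iff _).1 h
  exact (mem_ae_iff_prob_eq_one (measurableSet_future n MeasurableSet.univ)).2 h1

/-- As a function of the starting point this probability is harmonic strictly between m and n, with
boundary values 0 and 1, so its increment at m times the resistance is 1. -/
theorem real_climbAbove (hQ : IsWalkFamily p Q)
    (hp : ∀ k : ℕ, 1 ≤ k → 0 ≤ p k ∧ p k < 1 / 2) {m n : ℕ} (hmn : m < n) :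
    (Q (m + 1)).real (climbAbove m n) = (resistance p m n)⁻¹ := by
  have := hQ.prob
  set h : ℕ → ℝ := fun i => (Q i).real (climbAbove m n) with hh
  have hn : h n = 1 := by
    have : Set.univ =ᵐ[Q n] climbAbove m n := by
      filter_upwards [hQ.ae_start n] with y hy
      refine propext ⟨fun _ => ⟨0, ⟨hy, by simp⟩, fun i hi => ?_⟩, fun _ => trivial⟩
      obtain rfl : i = 0 := by omega
      omega
    simp only [hh]
    rw [← measureReal_congr this]; simp
  have hm : h m = 0 := by
    simp only [hh]
    rw [measureReal_eq_zero_iff, measure_eq_zero_iff_ae_notMem]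
    filter_upwards [hQ.ae_start m] with y hy hy'
    obtain ⟨l, _, hl⟩ := hy'
    have := hl 0 (Nat.zero_le _)
    omega
  have harm : ∀ i, m < i → i < n → h i = upProb p i * h (i + 1) + (1 - upProb p i) * h (i - 1) :=
    fun i hmi hi => hQ.real_eq_of_ae_shift_one i (measurableSet_climbAbove m n)
      fun y hy => shift_one_mem_climbAbove (by omega) (by omega)
  have key := harmonic_sub_eq hp harm hmn.le le_rfl
  rw [hn, hm, sub_zero, sub_zero] at key
  exact eq_inv_of_mul_eq_one_left key.symm

/-- The probability never to return to `m` from `m + 1` is the limit of the inverse resistances. -/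
theorem tendsto_inv_resistance (hQ : IsWalkFamily p Q)
    (hp : ∀ k : ℕ, 1 ≤ k → 0 ≤ p k ∧ p k < 1 / 2) (m : ℕ) :
    Tendsto (fun n => (resistance p m n)⁻¹) atTop (nhds ((Q (m + 1)).real (stayAbove m))) := by
  have := hQ.prob
  set G : Set (ℕ → ℕ) := {y | ∀ n, m < n → y ∈ future n Set.univ} with hG
  have hGae : ∀ᵐ y ∂Q (m + 1), y ∈ G := by
    refine ae_all_iff.2 fun n => ?_
    by_cases h : m < n
    · filter_upwards [hQ.ae_future_univ hp (show m + 1 ≤ n by omega)] with y hy _ using hy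
    · exact ae_of_all _ fun y h' => absurd h' h
  have hGm : MeasurableSet G := by
    have : G = ⋂ n, ⋂ (_ : m < n), future n Set.univ := by ext y; simp [hG]
    rw [this]
    exact MeasurableSet.iInter fun n => MeasurableSet.iInter fun _ =>
      measurableSet_future n MeasurableSet.univ
  -- On the almost sure event that every level is reached, climbing to a higher level implies
  -- climbing to a lower one, so these events decrease.
  set H : ℕ → Set (ℕ → ℕ) := fun k => climbAbove m (m + 1 + k) ∩ G with hH
  have hanti : Antitone H := by
    intro a b hab
    rintro y ⟨⟨l, hl, h⟩, hy⟩
    refine ⟨?_, hy⟩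
    obtain ⟨l', hl', _⟩ := hy (m + 1 + a) (by omega)
    have := hl'.mono (by omega) hl
    exact ⟨l', hl', fun i hi => h i (by omega)⟩
  have hlim : ⋂ k, H k =ᵐ[Q (m + 1)] stayAbove m := by
    filter_upwards [hGae] with y hy
    refine propext ⟨fun h t => ?_, fun h => ?_⟩
    -- A level above the sum of the values up to time t cannot be reached by time t, so the climb to
    -- it covers time t.
    · have h := Set.mem_iInter.1 h (∑ i ∈ Finset.range (t + 1), y i)
      obtain ⟨⟨l, hl, h⟩, _⟩ := h
      refine h t ?_
      by_contra hlt
      have h1 := hl.1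
      have h2 := Finset.single_le_sum (f := y) (fun i _ => Nat.zero_le _)
        (Finset.mem_range.2 (show l < t + 1 by omega))
      omega
    · refine Set.mem_iInter.2 fun k => ⟨?_, hy⟩
      obtain ⟨l, hl, _⟩ := hy (m + 1 + k) (by omega)
      exact ⟨l, hl, fun i _ => h i⟩
  have ht : Tendsto (fun k => (Q (m + 1)).real (H k)) atTop
      (nhds ((Q (m + 1)).real (stayAbove m))) := by
    rw [← measureReal_congr hlim]
    refine (ENNReal.tendsto_toReal (measure_ne_top _ _)).comp
      (tendsto_measure_iInter_atTop (fun k =>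
        ((measurableSet_climbAbove _ _).inter hGm).nullMeasurableSet) hanti
        ⟨0, measure_ne_top _ _⟩)
  have he : ∀ k, (Q (m + 1)).real (H k) = (resistance p m (k + (m + 1)))⁻¹ := by
    intro k
    rw [add_comm k, ← hQ.real_climbAbove hp (show m < m + 1 + k by omega)]
    refine measureReal_congr ?_
    filter_upwards [hGae] with y hy
    exact propext ⟨fun h => h.1, fun h => ⟨h, hy⟩⟩
  simp only [he] at ht
  exact (tendsto_add_atTop_iff_nat (f := fun n => (resistance p m n)⁻¹) (m + 1)).1 ht

end IsWalkFamily

/-! ### Cut events and what determines them -/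

theorem priorTo_future {m n : ℕ} (hmn : m ≤ n) {E : Set (ℕ → ℕ)}
    (hE : ∀ y y' l, y 0 = m → FirstPassage y n l → (∀ i ≤ l, y i = y' i) → y ∈ E → y' ∈ E) :
    PriorTo n (future m E) := by
  rintro s s' k hk hs ⟨j, hj, hjE⟩
  obtain ⟨l, rfl⟩ := Nat.exists_eq_add_of_le (hj.mono hmn hk)
  refine ⟨j, hj.congr fun i hi => hs i (by omega),
    hE _ _ l hj.1 ((hj.shift_iff hmn l).2 hk) (fun i hi => hs _ (by omega)) hjE⟩

theorem climbAbove_congr {m n l : ℕ} {y y' : ℕ → ℕ} (hl : FirstPassage y n l)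
    (hy : ∀ i ≤ l, y i = y' i) (h : y ∈ climbAbove m n) : y' ∈ climbAbove m n := by
  obtain ⟨l', hl', h⟩ := h
  obtain rfl := hl.unique hl'
  exact ⟨l, hl.congr hy, fun i hi => by rw [← hy i hi]; exact h i hi⟩

/-- The paths that, once they have reached `m + 1`, stay above `m`. -/
def weakCut (m : ℕ) : Set (ℕ → ℕ) := future (m + 1) (stayAbove m)

/-- The paths that have a strong cutpoint at `m`. -/
def strongCut (m : ℕ) : Set (ℕ → ℕ) := future m (shift 1 ⁻¹' stayAbove m)

/-- The paths that do not return to `m` between their first visits to `m` and to `n`. -/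
def localCut (m n : ℕ) : Set (ℕ → ℕ) := future m (shift 1 ⁻¹' climbAbove m n)

theorem mem_strongCut {m : ℕ} {s : ℕ → ℕ} : s ∈ strongCut m ↔ m ∈ strongCutpoints s := by
  constructor
  · rintro ⟨k, hk, h⟩
    refine ⟨k, hk.1, hk.2, fun i hi => ?_⟩
    have := h (i - (k + 1))
    rwa [shift_shift, shift, Nat.add_sub_cancel' hi] at this
  · rintro ⟨k, h1, h2, h3⟩
    exact ⟨k, ⟨h1, h2⟩, fun i => h3 _ (by omega)⟩

/-- The time that witnesses the cutpoint precedes the first passage to m + 1. Only this inclusion is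
needed, since cutpoints are to be bounded from above. -/
theorem mem_weakCut_of_mem_cutpoints {m : ℕ} {s : ℕ → ℕ} (hs : s ∈ future (m + 1) Set.univ)
    (h : m ∈ cutpoints s) : s ∈ weakCut m := by
  obtain ⟨l, hl, _⟩ := hs
  obtain ⟨k, h1, h2, h3⟩ := h
  have hkl : k < l := by
    by_contra hlt
    have := h2 l (by omega)
    rw [hl.1] at this
    omega
  exact ⟨l, hl, fun i => h3 _ (by omega)⟩

theorem measurableSet_weakCut (m : ℕ) : MeasurableSet (weakCut m) :=
  measurableSet_future _ (measurableSet_stayAbove m)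

theorem measurableSet_strongCut (m : ℕ) : MeasurableSet (strongCut m) :=
  measurableSet_future _ (measurable_shift 1 (measurableSet_stayAbove m))

theorem measurableSet_localCut (m n : ℕ) : MeasurableSet (localCut m n) :=
  measurableSet_future _ (measurable_shift 1 (measurableSet_climbAbove m n))

theorem priorTo_localCut {m n N : ℕ} (hmn : m < n) (hnN : n ≤ N) : PriorTo N (localCut m n) := by
  refine priorTo_future (hmn.le.trans hnN) fun y y' l h0 hl hy h => ?_
  obtain ⟨j, hj, h⟩ := h
  have hjl := ((shift_one_firstPassage (by omega) j).1 hj).mono hnN hl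
  have hs : ∀ i ≤ j, shift 1 y i = shift 1 y' i := fun i hi => hy _ (by omega)
  exact climbAbove_congr hj hs ⟨j, hj, h⟩

/-- `localCut m n` is the approximation from outside that is already decided at the first passage to
n, hence independent of what follows; both the pair correlation and the zero-one law rest on it. -/
theorem strongCut_subset_localCut {m n : ℕ} (hmn : m < n) {s : ℕ → ℕ}
    (hs : s ∈ future n Set.univ) (h : s ∈ strongCut m) : s ∈ localCut m n := by
  obtain ⟨k, hk, h⟩ := h
  obtain ⟨l, hl, _⟩ := hs
  obtain ⟨j, rfl⟩ := Nat.exists_eq_add_of_le (hk.mono hmn.le hl)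
  rcases j with _ | j
  · exact absurd (hk.1.symm.trans hl.1) hmn.ne
  · refine ⟨k, hk, j, ?_, fun i _ => h i⟩
    exact (shift_one_firstPassage (by simpa [shift, hk.1] using hmn) j).2
      ((hk.shift_iff hmn.le _).2 hl)

/-- The paths for which `n` is the last weak cutpoint below `b`. -/
def lastCut (n b : ℕ) : Set (ℕ → ℕ) :=
  future (n + 1) (stayAbove n ∩ ⋂ i ∈ Finset.Ioo n b, (weakCut i)ᶜ)

/-- Weak cuts at levels above n depend only on the path from the first passage to n + 1 on. Hence
the whole event is a future event for that passage, although it describes all later cuts. -/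
theorem mem_lastCut {n b : ℕ} {s : ℕ → ℕ} :
    s ∈ lastCut n b ↔ s ∈ weakCut n ∧ ∀ i ∈ Finset.Ioo n b, s ∉ weakCut i := by
  have key : ∀ k, FirstPassage s (n + 1) k → ∀ i ∈ Finset.Ioo n b,
      (shift k s ∈ weakCut i ↔ s ∈ weakCut i) := fun k hk i hi =>
    hk.shift_mem_future (by have := (Finset.mem_Ioo.1 hi).1; omega) _
  constructor
  · rintro ⟨k, hk, h1, h2⟩
    refine ⟨⟨k, hk, h1⟩, fun i hi => ?_⟩
    rw [← key k hk i hi]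
    exact Set.mem_iInter₂.1 h2 i hi
  · rintro ⟨⟨k, hk, h1⟩, h2⟩
    refine ⟨k, hk, h1, Set.mem_iInter₂.2 fun i hi => ?_⟩
    have := h2 i hi
    rwa [← key k hk i hi] at this

theorem measurableSet_lastCut_base (n b : ℕ) :
    MeasurableSet (stayAbove n ∩ ⋂ i ∈ Finset.Ioo n b, (weakCut i)ᶜ) :=
  (measurableSet_stayAbove n).inter
    (Finset.measurableSet_biInter _ fun i _ => (measurableSet_weakCut i).compl)

theorem measurableSet_lastCut (n b : ℕ) : MeasurableSet (lastCut n b) :=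
  measurableSet_future _ (measurableSet_lastCut_base n b)

theorem disjoint_lastCut {n n' b : ℕ} (h : n ≠ n') (hn : n < b) (hn' : n' < b) :
    Disjoint (lastCut n b) (lastCut n' b) := by
  rw [Set.disjoint_left]
  intro s h1 h2
  rw [mem_lastCut] at h1 h2
  rcases lt_or_gt_of_ne h with hlt | hlt
  · exact h1.2 n' (Finset.mem_Ioo.2 ⟨hlt, hn'⟩) h2.1
  · exact h2.2 n (Finset.mem_Ioo.2 ⟨hlt, hn⟩) h1.1

theorem exists_lastCut {a b n : ℕ} {s : ℕ → ℕ} (hn : n ∈ Finset.Ico a b) (hs : s ∈ weakCut n) :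
    ∃ n ∈ Finset.Ico a b, s ∈ lastCut n b := by
  classical
  have hne : ((Finset.Ico a b).filter fun i => s ∈ weakCut i).Nonempty :=
    ⟨n, Finset.mem_filter.2 ⟨hn, hs⟩⟩
  have hmax := Finset.max'_mem _ hne
  rw [Finset.mem_filter] at hmax
  refine ⟨_, hmax.1, mem_lastCut.2 ⟨hmax.2, fun i hi hsi => ?_⟩⟩
  rw [Finset.mem_Ioo] at hi
  have h1 := Finset.mem_Ico.1 hmax.1
  have := Finset.le_max' ((Finset.Ico a b).filter fun i => s ∈ weakCut i) i (Finset.mem_filter.2 ⟨Finset.mem_Ico.2 ⟨by omega, hi.2⟩, hsi⟩)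
  omega

/-- The path avoids m on the climb to n + 1, and from there on it stays above n ≥ m. -/
theorem weakCut_of_climbAbove {m n b : ℕ} {s : ℕ → ℕ} (hmn : m ≤ n)
    (h : s ∈ future (m + 1) (climbAbove m (n + 1))) (hL : s ∈ lastCut n b) : s ∈ weakCut m := by
  obtain ⟨k, hk, l, hl, h⟩ := h
  obtain ⟨⟨k', hk', h'⟩, _⟩ := mem_lastCut.1 hL
  obtain rfl : k' = k + l := hk'.unique ((hk.shift_iff (by omega) l).1 hl)
  refine ⟨k, hk, fun i => ?_⟩
  rcases Nat.lt_or_ge l i with hi | hi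
  · have := h' (i - l)
    rw [shift, show k + l + (i - l) = k + i by omega] at this
    rw [shift]; omega
  · exact h i hi

/-! ### Probabilities of cut events and the clustering bound -/

namespace IsWalkFamily

variable {p : ℕ → ℝ} {Q : ℕ → Measure (ℕ → ℕ)}

/-- Since the level n is almost surely reached, the strong Markov property becomes independence of
past and future. -/
theorem real_inter_future (hQ : IsWalkFamily p Q)
    (hp : ∀ k : ℕ, 1 ≤ k → 0 ≤ p k ∧ p k < 1 / 2) {n : ℕ} {S E : Set (ℕ → ℕ)}
    (hS : PriorTo n S) (hE : MeasurableSet E) :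
    (Q 0).real (S ∩ future n E) = (Q 0).real S * (Q n).real E := by
  rw [measureReal_def, hQ.strong_markov 0 hS hE, ENNReal.toReal_mul]
  congr 1
  refine measureReal_congr ?_
  filter_upwards [hQ.ae_future_univ hp (Nat.zero_le n)] with s hs
  exact propext ⟨fun h => h.1, fun h => ⟨h, hs⟩⟩

theorem real_future (hQ : IsWalkFamily p Q)
    (hp : ∀ k : ℕ, 1 ≤ k → 0 ≤ p k ∧ p k < 1 / 2) {n : ℕ} {E : Set (ℕ → ℕ)}
    (hE : MeasurableSet E) : (Q 0).real (future n E) = (Q n).real E := by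
  have := hQ.prob 0
  have := hQ.real_inter_future hp (priorTo_univ n) hE
  simpa using this

theorem real_weakCut (hQ : IsWalkFamily p Q)
    (hp : ∀ k : ℕ, 1 ≤ k → 0 ≤ p k ∧ p k < 1 / 2) (m : ℕ) :
    (Q 0).real (weakCut m) = (Q (m + 1)).real (stayAbove m) :=
  hQ.real_future hp (measurableSet_stayAbove m)

theorem real_shift_one_of_start (hQ : IsWalkFamily p Q) (m : ℕ) {E : Set (ℕ → ℕ)}
    (hE : MeasurableSet E) (h : ∀ y ∈ E, m < y 0) :
    (Q m).real (shift 1 ⁻¹' E) = upProb p m * (Q (m + 1)).real E := by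
  have h0 : (Q (m - 1)).real E = 0 := by
    have := hQ.prob
    rw [measureReal_eq_zero_iff, measure_eq_zero_iff_ae_notMem]
    filter_upwards [hQ.ae_start (m - 1)] with y hy hy'
    have := h y hy'
    omega
  rw [hQ.real_shift_one m hE, h0, mul_zero, add_zero]

theorem real_strongCut (hQ : IsWalkFamily p Q)
    (hp : ∀ k : ℕ, 1 ≤ k → 0 ≤ p k ∧ p k < 1 / 2) (m : ℕ) :
    (Q 0).real (strongCut m) = upProb p m * (Q (m + 1)).real (stayAbove m) := by
  rw [strongCut, hQ.real_future hp (measurable_shift 1 (measurableSet_stayAbove m)),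
    hQ.real_shift_one_of_start m (measurableSet_stayAbove m) fun y hy => hy 0]

theorem real_localCut (hQ : IsWalkFamily p Q)
    (hp : ∀ k : ℕ, 1 ≤ k → 0 ≤ p k ∧ p k < 1 / 2) {m n : ℕ} (hmn : m < n) :
    (Q 0).real (localCut m n) = upProb p m * (resistance p m n)⁻¹ := by
  rw [localCut, hQ.real_future hp (measurable_shift 1 (measurableSet_climbAbove m n)),
    hQ.real_shift_one_of_start m (measurableSet_climbAbove m n), hQ.real_climbAbove hp hmn]
  rintro y ⟨l, _, h⟩
  exact h 0 (Nat.zero_le _)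

/-- The pair correlation of strong cutpoints. -/
theorem real_strongCut_inter_le (hQ : IsWalkFamily p Q)
    (hp : ∀ k : ℕ, 1 ≤ k → 0 ≤ p k ∧ p k < 1 / 2) {m n : ℕ} (hmn : m < n) :
    (Q 0).real (strongCut m ∩ strongCut n) ≤
      (resistance p m n)⁻¹ * (Q 0).real (strongCut n) := by
  have := hQ.prob
  have h1 : (Q 0).real (strongCut m ∩ strongCut n) ≤ (Q 0).real (localCut m n ∩ strongCut n) :=
    measureReal_mono fun s hs => ⟨strongCut_subset_localCut hmn
      (by obtain ⟨k, hk, _⟩ := hs.2; exact ⟨k, hk, trivial⟩) hs.1, hs.2⟩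
  refine h1.trans ?_
  rw [strongCut, hQ.real_inter_future hp (priorTo_localCut hmn le_rfl)
    (measurable_shift 1 (measurableSet_stayAbove n)), hQ.real_localCut hp hmn,
    hQ.real_future hp (measurable_shift 1 (measurableSet_stayAbove n))]
  have h2 := one_le_resistance hp hmn
  refine mul_le_mul_of_nonneg_right ?_ measureReal_nonneg
  exact mul_le_of_le_one_left (inv_nonneg.2 (by linarith)) (upProb_le_one hp m)

/-- If there is a weak cutpoint in `[a, b)`, then there are on average at least `log (a - c)` many
in `[c, b)`. -/
theorem real_biUnion_weakCut_mul_log_le (hQ : IsWalkFamily p Q)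
    (hp : ∀ k : ℕ, 1 ≤ k → 0 ≤ p k ∧ p k < 1 / 2) (a b c : ℕ) :
    (Q 0).real (⋃ n ∈ Finset.Ico a b, weakCut n) * Real.log (a - c + 1 : ℕ) ≤
      ∑ m ∈ Finset.Ico c b, (Q (m + 1)).real (stayAbove m) := by
  have := hQ.prob
  set P := (Q 0).real with hP
  have h1 : P (⋃ n ∈ Finset.Ico a b, weakCut n) ≤ ∑ n ∈ Finset.Ico a b, P (lastCut n b) := by
    refine (measureReal_mono (s₂ := ⋃ n ∈ Finset.Ico a b, lastCut n b) ?_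
      (measure_ne_top _ _)).trans
      (measureReal_biUnion_finset_le _ _)
    intro s hs
    simp only [Set.mem_iUnion, exists_prop] at hs ⊢
    obtain ⟨n, hn, hs⟩ := hs
    exact exists_lastCut hn hs
  have h2 : ∀ m, ∑ n ∈ Finset.Ico a b, P (weakCut m ∩ lastCut n b) ≤
      (Q (m + 1)).real (stayAbove m) := by
    intro m
    rw [← hQ.real_weakCut hp, ← measureReal_biUnion_finset]
    · exact measureReal_mono (Set.iUnion₂_subset fun n _ => Set.inter_subset_left)
    · intro i hi j hj hij
      exact (disjoint_lastCut hij (Finset.mem_Ico.1 hi).2 (Finset.mem_Ico.1 hj).2).mono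
        Set.inter_subset_right Set.inter_subset_right
    · exact fun n _ => (measurableSet_weakCut m).inter (measurableSet_lastCut n b)
  -- The climb from m + 1 to n + 1 above m is prior to the passage to n + 1, hence independent of
  -- `lastCut n b`; its probability is 1/R(m, n+1).
  have h3 : ∀ m n, m ≤ n →
      ((n + 1 - m : ℕ) : ℝ)⁻¹ * P (lastCut n b) ≤ P (weakCut m ∩ lastCut n b) := by
    intro m n hmn
    have hprior : PriorTo (n + 1) (future (m + 1) (climbAbove m (n + 1))) :=
      priorTo_future (by omega) fun y y' l _ hl hy h => climbAbove_congr hl hy h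
    have e : P (future (m + 1) (climbAbove m (n + 1)) ∩ lastCut n b) =
        (resistance p m (n + 1))⁻¹ * P (lastCut n b) := by
      rw [hP, lastCut, hQ.real_inter_future hp hprior (measurableSet_lastCut_base n b),
        hQ.real_future hp (measurableSet_climbAbove _ _),
        hQ.real_future hp (measurableSet_lastCut_base n b), hQ.real_climbAbove hp (by omega)]
    have h4 := resistance_le_sub hp (show m ≤ n + 1 by omega)
    have h5 := one_le_resistance hp (show m < n + 1 by omega)
    calc ((n + 1 - m : ℕ) : ℝ)⁻¹ * P (lastCut n b)
        ≤ (resistance p m (n + 1))⁻¹ * P (lastCut n b) := by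
          refine mul_le_mul_of_nonneg_right (inv_anti₀ (by linarith) ?_) measureReal_nonneg
          rwa [Nat.cast_sub (by omega)]
      _ = P (future (m + 1) (climbAbove m (n + 1)) ∩ lastCut n b) := e.symm
      _ ≤ P (weakCut m ∩ lastCut n b) :=
          measureReal_mono fun s hs => ⟨weakCut_of_climbAbove hmn hs.1 hs.2, hs.2⟩
  -- Summing the bounds 1/(n + 1 - m) over m from c to n gives a harmonic number, which dominates
  -- the logarithm.
  have h4 : ∀ n ∈ Finset.Ico a b, Real.log (a - c + 1 : ℕ) * P (lastCut n b) ≤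
      ∑ m ∈ Finset.Ico c b, P (weakCut m ∩ lastCut n b) := by
    intro n hn
    rw [Finset.mem_Ico] at hn
    have h5 : ∑ m ∈ Finset.Ico c (n + 1), ((n + 1 - m : ℕ) : ℝ)⁻¹ =
        (harmonic (n + 1 - c) : ℝ) := by
      rw [harmonic, ← Finset.sum_range_reflect, Finset.sum_Ico_eq_sum_range]
      push_cast
      refine Finset.sum_congr rfl fun i hi => ?_
      rw [Finset.mem_range] at hi
      congr 1
      rw [show n + 1 - (c + i) = n + 1 - c - 1 - i + 1 by omega]
      push_cast; ring
    have h6 : Real.log (a - c + 1 : ℕ) ≤ (harmonic (n + 1 - c) : ℝ) := by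
      refine le_trans (Real.log_le_log (by positivity) ?_) (log_add_one_le_harmonic _)
      exact_mod_cast (show a - c + 1 ≤ n + 1 - c + 1 by omega)
    calc Real.log (a - c + 1 : ℕ) * P (lastCut n b)
        ≤ (∑ m ∈ Finset.Ico c (n + 1), ((n + 1 - m : ℕ) : ℝ)⁻¹) * P (lastCut n b) := by
          rw [h5]; exact mul_le_mul_of_nonneg_right h6 measureReal_nonneg
      _ = ∑ m ∈ Finset.Ico c (n + 1), ((n + 1 - m : ℕ) : ℝ)⁻¹ * P (lastCut n b) :=
          Finset.sum_mul _ _ _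
      _ ≤ ∑ m ∈ Finset.Ico c (n + 1), P (weakCut m ∩ lastCut n b) :=
          Finset.sum_le_sum fun m hm => h3 m n (by have := (Finset.mem_Ico.1 hm).2; omega)
      _ ≤ ∑ m ∈ Finset.Ico c b, P (weakCut m ∩ lastCut n b) :=
          Finset.sum_le_sum_of_subset_of_nonneg (Finset.Ico_subset_Ico_right (by omega))
            fun _ _ _ => measureReal_nonneg
  calc P (⋃ n ∈ Finset.Ico a b, weakCut n) * Real.log (a - c + 1 : ℕ)
      ≤ (∑ n ∈ Finset.Ico a b, P (lastCut n b)) * Real.log (a - c + 1 : ℕ) :=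
        mul_le_mul_of_nonneg_right h1 (Real.log_natCast_nonneg _)
    _ = ∑ n ∈ Finset.Ico a b, Real.log (a - c + 1 : ℕ) * P (lastCut n b) := by
        rw [Finset.sum_mul]; exact Finset.sum_congr rfl fun _ _ => mul_comm _ _
    _ ≤ ∑ n ∈ Finset.Ico a b, ∑ m ∈ Finset.Ico c b, P (weakCut m ∩ lastCut n b) :=
        Finset.sum_le_sum h4
    _ = ∑ m ∈ Finset.Ico c b, ∑ n ∈ Finset.Ico a b, P (weakCut m ∩ lastCut n b) :=
        Finset.sum_comm
    _ ≤ ∑ m ∈ Finset.Ico c b, (Q (m + 1)).real (stayAbove m) :=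
        Finset.sum_le_sum fun m _ => h2 m

/-- Convergence criterion: the dyadic blocks that contain a cutpoint are almost surely finite in
number. -/
theorem ae_finite_cutpoints (hQ : IsWalkFamily p Q)
    (hp : ∀ k : ℕ, 1 ≤ k → 0 ≤ p k ∧ p k < 1 / 2)
    (hs : Summable fun k : ℕ =>
      (∑ m ∈ Finset.Ico (2 ^ k) (2 ^ (k + 2)), (Q (m + 1)).real (stayAbove m)) / (k : ℝ)) :
    ∀ᵐ s ∂Q 0, (cutpoints s).Finite := by
  have := hQ.prob
  -- The expected count starts at 2^k, one dyadic block lower, so that every site of the block has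
  -- at least 2^k counted sites below it.
  set C : ℕ → Set (ℕ → ℕ) := fun k => ⋃ n ∈ Finset.Ico (2 ^ (k + 1)) (2 ^ (k + 2)), weakCut n
  have hC : ∀ k : ℕ, 1 ≤ k → (Q 0).real (C k) ≤ (Real.log 2)⁻¹ *
      ((∑ m ∈ Finset.Ico (2 ^ k) (2 ^ (k + 2)), (Q (m + 1)).real (stayAbove m)) / (k : ℝ)) := by
    intro k hk
    have h1 := hQ.real_biUnion_weakCut_mul_log_le hp (2 ^ (k + 1)) (2 ^ (k + 2)) (2 ^ k)
    have h2 : (k : ℝ) * Real.log 2 ≤ Real.log (2 ^ (k + 1) - 2 ^ k + 1 : ℕ) := by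
      rw [← Real.log_pow]
      refine Real.log_le_log (by positivity) ?_
      have : 2 ^ k ≤ 2 ^ (k + 1) - 2 ^ k + 1 := by rw [pow_succ]; omega
      exact_mod_cast this
    have h3 := (mul_le_mul_of_nonneg_left h2 (measureReal_nonneg (μ := Q 0) (s := C k))).trans h1
    have hl : 0 < Real.log 2 := Real.log_pos (by norm_num)
    have hk' : (0 : ℝ) < k := by exact_mod_cast hk
    rw [← div_eq_inv_mul, le_div_iff₀ hl, le_div_iff₀ hk']
    linarith
  have hsum : Summable fun k => (Q 0).real (C k) := by
    refine Summable.of_norm_bounded_eventually_nat (hs.mul_left (Real.log 2)⁻¹) ?_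
    filter_upwards [eventually_ge_atTop 1] with k hk
    rw [Real.norm_of_nonneg measureReal_nonneg]
    exact hC k hk
  have htsum : ∑' k, Q 0 (C k) ≠ ⊤ := by
    have : ∀ k, Q 0 (C k) = ENNReal.ofReal ((Q 0).real (C k)) := fun k =>
      (ofReal_measureReal (measure_ne_top _ _)).symm
    simp only [this]
    exact hsum.tsum_ofReal_ne_top
  have hall : ∀ᵐ s ∂Q 0, ∀ n, s ∈ future n Set.univ :=
    ae_all_iff.2 fun n => hQ.ae_future_univ hp (Nat.zero_le n)
  filter_upwards [ae_eventually_notMem htsum, hall] with s hsC hall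
  obtain ⟨K, hK⟩ := eventually_atTop.1 hsC
  refine (Set.finite_lt_nat (2 ^ (K + 1))).subset fun R hR => ?_
  change R < 2 ^ (K + 1)
  by_contra hlt
  have hlog : K + 1 ≤ Nat.log 2 R := Nat.le_log_of_pow_le (by norm_num) (by omega)
  have hR0 : R ≠ 0 := by have := Nat.one_le_two_pow (n := K + 1); omega
  refine hK (Nat.log 2 R - 1) (by omega) ?_
  refine Set.mem_iUnion₂.2 ⟨R, ?_, mem_weakCut_of_mem_cutpoints (hall _) hR⟩
  rw [Finset.mem_Ico, show Nat.log 2 R - 1 + 1 = Nat.log 2 R by omega,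
    show Nat.log 2 R - 1 + 2 = Nat.log 2 R + 1 by omega]
  exact ⟨Nat.pow_log_le_self 2 hR0, Nat.lt_pow_succ_log_self (by norm_num) R⟩

end IsWalkFamily

/-! ### The second moment method -/

/-- The second moment method for a weighted count of events. -/
theorem sq_sum_mul_real_le {Ω ι : Type*} [MeasurableSpace Ω] (μ : Measure Ω) [IsFiniteMeasure μ]
    (F : Finset ι) {B : ι → Set Ω} (hB : ∀ i, MeasurableSet (B i)) (w : ι → ℝ) :
    (∑ i ∈ F, w i * μ.real (B i)) ^ 2 ≤
      μ.real (⋃ i ∈ F, B i) * ∑ i ∈ F, ∑ j ∈ F, w i * w j * μ.real (B i ∩ B j) := by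
  set U := ⋃ i ∈ F, B i with hU
  have hUm : MeasurableSet U := Finset.measurableSet_biUnion _ fun i _ => hB i
  have hint : ∀ {A : Set Ω}, MeasurableSet A → Integrable (A.indicator (1 : Ω → ℝ)) μ :=
    fun hA => (integrable_const (1 : ℝ)).indicator hA
  have hmul : ∀ (A A' : Set Ω) (ω : Ω), A.indicator (1 : Ω → ℝ) ω * A'.indicator (1 : Ω → ℝ) ω =
      (A ∩ A').indicator (1 : Ω → ℝ) ω := by
    intro A A' ω
    by_cases h1 : ω ∈ A <;> by_cases h2 : ω ∈ A' <;> simp [h1, h2]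
  -- The weighted count vanishes off the union U. Hence the mean square of count minus t times the
  -- indicator of U is this quadratic in t, and the claim is that its discriminant is at most 0.
  have key : ∀ t : ℝ, 0 ≤ μ.real U * (t * t) + (-2 * ∑ i ∈ F, w i * μ.real (B i)) * t +
      ∑ i ∈ F, ∑ j ∈ F, w i * w j * μ.real (B i ∩ B j) := by
    intro t
    have e : ∀ ω, (∑ i ∈ F, w i * (B i).indicator (1 : Ω → ℝ) ω -
        t * U.indicator (1 : Ω → ℝ) ω) ^ 2 =
        t * t * U.indicator (1 : Ω → ℝ) ω +
          ∑ i ∈ F, (-2 * t * w i) * (B i).indicator (1 : Ω → ℝ) ω +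
          ∑ i ∈ F, ∑ j ∈ F, (w i * w j) * (B i ∩ B j).indicator (1 : Ω → ℝ) ω := by
      intro ω
      have e1 : (∑ i ∈ F, w i * (B i).indicator (1 : Ω → ℝ) ω) * U.indicator (1 : Ω → ℝ) ω =
          ∑ i ∈ F, w i * (B i).indicator (1 : Ω → ℝ) ω := by
        rw [Finset.sum_mul]
        refine Finset.sum_congr rfl fun i hi => ?_
        rw [mul_assoc, hmul, Set.inter_eq_left.2 (show B i ⊆ U from fun x hx => Set.mem_iUnion₂.2 ⟨i, hi, hx⟩)]
      have e2 : U.indicator (1 : Ω → ℝ) ω * U.indicator (1 : Ω → ℝ) ω =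
          U.indicator (1 : Ω → ℝ) ω := by rw [hmul, Set.inter_self]
      have e3 : (∑ i ∈ F, w i * (B i).indicator (1 : Ω → ℝ) ω) *
          (∑ i ∈ F, w i * (B i).indicator (1 : Ω → ℝ) ω) =
          ∑ i ∈ F, ∑ j ∈ F, (w i * w j) * (B i ∩ B j).indicator (1 : Ω → ℝ) ω := by
        rw [Finset.sum_mul_sum]
        refine Finset.sum_congr rfl fun i _ => Finset.sum_congr rfl fun j _ => ?_
        rw [← hmul]; ring
      have e4 : ∑ i ∈ F, (-2 * t * w i) * (B i).indicator (1 : Ω → ℝ) ω =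
          -2 * t * ∑ i ∈ F, w i * (B i).indicator (1 : Ω → ℝ) ω := by
        rw [Finset.mul_sum]; exact Finset.sum_congr rfl fun i _ => by ring
      rw [← e3, e4]
      linear_combination (-2 * t) * e1 + t * t * e2
    have h0 : 0 ≤ ∫ ω, (∑ i ∈ F, w i * (B i).indicator (1 : Ω → ℝ) ω -
        t * U.indicator (1 : Ω → ℝ) ω) ^ 2 ∂μ := integral_nonneg fun ω => sq_nonneg _
    simp only [e] at h0
    have i1 := (hint hUm).const_mul (t * t)
    have i2 : Integrable (fun ω => ∑ i ∈ F, (-2 * t * w i) * (B i).indicator (1 : Ω → ℝ) ω) μ :=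
      integrable_finsetSum _ fun i _ => (hint (hB i)).const_mul _
    have i3 : ∀ i, Integrable
        (fun ω => ∑ j ∈ F, (w i * w j) * (B i ∩ B j).indicator (1 : Ω → ℝ) ω) μ := fun i =>
      integrable_finsetSum _ fun j _ => (hint ((hB i).inter (hB j))).const_mul _
    have i12 : Integrable (fun ω => t * t * U.indicator (1 : Ω → ℝ) ω +
        ∑ i ∈ F, (-2 * t * w i) * (B i).indicator (1 : Ω → ℝ) ω) μ := i1.add i2
    rw [integral_add i12 (integrable_finsetSum _ fun i _ => i3 i), integral_add i1 i2,
      integral_finsetSum _ fun i _ => (hint (hB i)).const_mul _,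
      integral_finsetSum _ fun i _ => i3 i] at h0
    have e5 : ∀ i, ∫ ω, ∑ j ∈ F, (w i * w j) * (B i ∩ B j).indicator (1 : Ω → ℝ) ω ∂μ =
        ∑ j ∈ F, w i * w j * μ.real (B i ∩ B j) := by
      intro i
      rw [integral_finsetSum _ fun j _ => (hint ((hB i).inter (hB j))).const_mul _]
      refine Finset.sum_congr rfl fun j _ => ?_
      rw [integral_const_mul, integral_indicator_one ((hB i).inter (hB j))]
    simp only [e5, integral_const_mul, integral_indicator_one hUm] at h0
    have e6 : ∑ i ∈ F, -2 * t * w i * ∫ ω, (B i).indicator (1 : Ω → ℝ) ω ∂μ =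
        (-2 * ∑ i ∈ F, w i * μ.real (B i)) * t := by
      rw [Finset.mul_sum, Finset.sum_mul]
      refine Finset.sum_congr rfl fun i _ => ?_
      rw [integral_indicator_one (hB i)]; ring
    rw [e6] at h0
    linarith
  have := discrim_le_zero key
  rw [discrim] at this
  linarith

/-! ### The zero-one law -/

/-- The paths without strong cutpoints from `M` on. -/
def noStrongCut (M : ℕ) : Set (ℕ → ℕ) := {s | ∀ m, M ≤ m → s ∉ strongCut m}

theorem measurableSet_noStrongCut (M : ℕ) : MeasurableSet (noStrongCut M) := by
  have e : noStrongCut M = ⋂ m, ⋂ (_ : M ≤ m), (strongCut m)ᶜ := by ext y; simp [noStrongCut]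
  rw [e]
  exact MeasurableSet.iInter fun m => MeasurableSet.iInter fun _ =>
    (measurableSet_strongCut m).compl

theorem FirstPassage.shift_mem_noStrongCut {s : ℕ → ℕ} {n k : ℕ} (h : FirstPassage s n k) :
    shift k s ∈ noStrongCut n ↔ s ∈ noStrongCut n :=
  forall₂_congr fun _ hm => not_congr (h.shift_mem_future hm _)

namespace IsWalkFamily

variable {p : ℕ → ℝ} {Q : ℕ → Measure (ℕ → ℕ)}

theorem real_inter_noStrongCut (hQ : IsWalkFamily p Q)
    (hp : ∀ k : ℕ, 1 ≤ k → 0 ≤ p k ∧ p k < 1 / 2) {n : ℕ} {S : Set (ℕ → ℕ)} (hS : PriorTo n S) :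
    (Q 0).real (S ∩ noStrongCut n) = (Q 0).real S * (Q 0).real (noStrongCut n) := by
  have hae : noStrongCut n =ᵐ[Q 0] future n (noStrongCut n) := by
    filter_upwards [hQ.ae_future_univ hp (Nat.zero_le n)] with s hs
    obtain ⟨k, hk, _⟩ := hs
    apply propext
    change s ∈ noStrongCut n ↔ s ∈ future n (noStrongCut n)
    rw [hk.mem_future, hk.shift_mem_noStrongCut]
  rw [measureReal_congr ((ae_eq_refl S).inter hae),
    hQ.real_inter_future hp hS (measurableSet_noStrongCut n), measureReal_congr hae,
    hQ.real_future hp (measurableSet_noStrongCut n)]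

theorem tendsto_real_localCut (hQ : IsWalkFamily p Q)
    (hp : ∀ k : ℕ, 1 ≤ k → 0 ≤ p k ∧ p k < 1 / 2) (m : ℕ) :
    Tendsto (fun n => (Q 0).real (localCut m n)) atTop (nhds ((Q 0).real (strongCut m))) := by
  rw [hQ.real_strongCut hp]
  refine ((hQ.tendsto_inv_resistance hp m).const_mul (upProb p m)).congr' ?_
  filter_upwards [eventually_gt_atTop m] with n hn
  rw [hQ.real_localCut hp hn]

theorem strongCut_ae_le_localCut (hQ : IsWalkFamily p Q)
    (hp : ∀ k : ℕ, 1 ≤ k → 0 ≤ p k ∧ p k < 1 / 2) {m n : ℕ} (hmn : m < n) :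
    ∀ᵐ s ∂Q 0, s ∈ strongCut m → s ∈ localCut m n := by
  filter_upwards [hQ.ae_future_univ hp (Nat.zero_le n)] with s hs h
  exact strongCut_subset_localCut hmn hs h

theorem real_localCut_diff (hQ : IsWalkFamily p Q)
    (hp : ∀ k : ℕ, 1 ≤ k → 0 ≤ p k ∧ p k < 1 / 2) {m n : ℕ} (hmn : m < n) :
    (Q 0).real (localCut m n \ strongCut m) =
      (Q 0).real (localCut m n) - (Q 0).real (strongCut m) := by
  have := hQ.prob 0
  have h1 := measureReal_inter_add_sdiff (μ := Q 0) (s := localCut m n) (measurableSet_strongCut m)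
  have h2 : (localCut m n ∩ strongCut m : Set (ℕ → ℕ)) =ᵐ[Q 0] strongCut m := by
    filter_upwards [hQ.strongCut_ae_le_localCut hp hmn] with s hs
    exact propext ⟨fun h => h.2, fun h => ⟨hs h, h⟩⟩
  rw [measureReal_congr h2] at h1
  linarith

/-- Zero-one law: if strong cutpoints beyond `M` exist with a probability that is bounded below,
then there are almost surely infinitely many. -/
theorem ae_infinite_strongCutpoints (hQ : IsWalkFamily p Q)
    (hp : ∀ k : ℕ, 1 ≤ k → 0 ≤ p k ∧ p k < 1 / 2) {c : ℝ} (hc : 0 < c)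
    (h : ∀ᶠ M in atTop, ∃ F : Finset ℕ, (∀ m ∈ F, M ≤ m) ∧
      c ≤ (Q 0).real (⋃ m ∈ F, strongCut m)) :
    ∀ᵐ s ∂Q 0, (strongCutpoints s).Infinite := by
  have := hQ.prob
  obtain ⟨M₀, hM₀⟩ := eventually_atTop.1 h
  set P := (Q 0).real with hP
  set u := ⨆ k, P (noStrongCut (M₀ + k)) with hu
  have hbdd : BddAbove (Set.range fun k => P (noStrongCut (M₀ + k))) :=
    ⟨1, by rintro _ ⟨k, rfl⟩; exact measureReal_le_one⟩
  have hle : ∀ n, M₀ ≤ n → P (noStrongCut n) ≤ u := fun n hn => by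
    obtain ⟨k, rfl⟩ := Nat.exists_eq_add_of_le hn
    exact le_ciSup hbdd k
  have hu0 : 0 ≤ u := measureReal_nonneg.trans (hle M₀ le_rfl)
  -- Take n so large that local and strong cuts in F differ by at most ε. Without strong cuts from
  -- M₀ + k on, either some local cut in F is undone after reaching n, or F has no local cut; the
  -- latter has probability at most 1 - c and is independent of the absence of strong cuts from n
  -- on.
  have step : ∀ k, P (noStrongCut (M₀ + k)) ≤ (1 - c) * u := by
    intro k
    obtain ⟨F, hF, hcF⟩ := hM₀ (M₀ + k) (by omega)
    refine le_of_forall_pos_le_add fun ε hε => ?_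
    have hlim : Tendsto (fun n => ∑ m ∈ F, (P (localCut m n) - P (strongCut m))) atTop
        (nhds 0) := by
      have := tendsto_finsetSum F fun m _ =>
        (hQ.tendsto_real_localCut hp m).sub_const ((Q 0).real (strongCut m))
      simpa using this
    obtain ⟨n, hn1, hn2, hn3⟩ := ((hlim.eventually_le_const hε).and
      ((eventually_ge_atTop (M₀ + k)).and (eventually_gt_atTop (F.sup id)))).exists
    have hFn : ∀ m ∈ F, m < n := fun m hm => (Finset.le_sup (f := id) hm).trans_lt hn3
    set W := ⋃ m ∈ F, localCut m n with hW
    have hWm : MeasurableSet W := Finset.measurableSet_biUnion _ fun m _ => measurableSet_localCut m n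
    have hWprior : PriorTo n W := by
      intro s s' l hl hs hsW
      obtain ⟨m, hm, hsm⟩ := Set.mem_iUnion₂.1 hsW
      exact Set.mem_iUnion₂.2 ⟨m, hm, priorTo_localCut (hFn m hm) le_rfl s s' l hl hs hsm⟩
    have hWc : P Wᶜ ≤ 1 - c := by
      have h1 : P (⋃ m ∈ F, strongCut m) ≤ P W := by
        refine ENNReal.toReal_mono (measure_ne_top _ _) (measure_mono_ae ?_)
        have hall : ∀ᵐ s ∂Q 0, s ∈ future n Set.univ := hQ.ae_future_univ hp (Nat.zero_le n)
        filter_upwards [hall] with s hs hsU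
        obtain ⟨m, hm, hsm⟩ := Set.mem_iUnion₂.1 hsU
        exact Set.mem_iUnion₂.2 ⟨m, hm, strongCut_subset_localCut (hFn m hm) hs hsm⟩
      have h2 := measureReal_compl (μ := Q 0) hWm
      rw [probReal_univ] at h2
      change P Wᶜ = 1 - P W at h2
      linarith
    have hsub : noStrongCut (M₀ + k) ⊆
        (Wᶜ ∩ noStrongCut n) ∪ ⋃ m ∈ F, (localCut m n \ strongCut m) := by
      intro s hs
      by_cases hsW : s ∈ W
      · obtain ⟨m, hm, hsm⟩ := Set.mem_iUnion₂.1 hsW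
        exact Or.inr (Set.mem_iUnion₂.2 ⟨m, hm, hsm, hs m (hF m hm)⟩)
      · exact Or.inl ⟨hsW, fun m hm => hs m (hn2.trans hm)⟩
    calc P (noStrongCut (M₀ + k))
        ≤ P (Wᶜ ∩ noStrongCut n) + P (⋃ m ∈ F, (localCut m n \ strongCut m)) :=
          (measureReal_mono hsub (measure_ne_top _ _)).trans (measureReal_union_le _ _)
      _ ≤ P Wᶜ * P (noStrongCut n) + ∑ m ∈ F, P (localCut m n \ strongCut m) := by
          rw [hP, hQ.real_inter_noStrongCut hp hWprior.compl]
          gcongr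
          exact measureReal_biUnion_finset_le _ _
      _ ≤ (1 - c) * u + ε := by
          have h3 : ∑ m ∈ F, P (localCut m n \ strongCut m) ≤ ε := by
            refine le_trans (le_of_eq (Finset.sum_congr rfl fun m hm => ?_)) hn1
            exact hQ.real_localCut_diff hp (hFn m hm)
          have h4 : P Wᶜ * P (noStrongCut n) ≤ (1 - c) * u :=
            mul_le_mul hWc (hle n (by omega)) measureReal_nonneg
              (measureReal_nonneg.trans hWc)
          linarith
  have hu1 : u ≤ (1 - c) * u := ciSup_le step
  have hu2 : u = 0 := by nlinarith
  have hzero : ∀ᵐ s ∂Q 0, ∀ k, s ∉ noStrongCut (M₀ + k) := by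
    refine ae_all_iff.2 fun k => measure_eq_zero_iff_ae_notMem.1 ?_
    rw [← measureReal_eq_zero_iff]
    exact le_antisymm ((hle _ (by omega)).trans hu2.le) measureReal_nonneg
  filter_upwards [hzero] with s hs hfin
  obtain ⟨b, hb⟩ := hfin.bddAbove
  refine hs (b + 1) fun m hm hsm => ?_
  have := hb (mem_strongCut.1 hsm)
  omega

end IsWalkFamily

/-! ### Comparison of resistances with a gauge -/

section Comparison

variable {p : ℕ → ℝ}

theorem resistance_self (m : ℕ) : resistance p m m = 0 := by simp [resistance]

theorem resistance_eq_one_add {m n : ℕ} (hmn : m < n) :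
    resistance p m n = 1 + oddsDown p (m + 1) * resistance p (m + 1) n := by
  rw [resistance, Finset.sum_eq_sum_Ico_succ_bot hmn, resistance, Finset.mul_sum]
  congr 1
  · simp
  · refine Finset.sum_congr rfl fun j hj => ?_
    rw [← Finset.prod_Ioc_consecutive (oddsDown p) (Nat.le_succ m) (Finset.mem_Ico.1 hj).1]
    simp

theorem prod_oddsDown_eq_mul {m n : ℕ} (hmn : m < n) :
    ∏ i ∈ Finset.Ioc m n, oddsDown p i =
      oddsDown p (m + 1) * ∏ i ∈ Finset.Ioc (m + 1) n, oddsDown p i := by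
  rw [← Finset.prod_Ioc_consecutive (oddsDown p) (Nat.le_succ m) hmn]
  simp

/-- `g` is, up to the factor `2`, both a supersolution and a subsolution of the recursion for the
resistances from `M` on. -/
structure IsGauge (p : ℕ → ℝ) (g : ℕ → ℝ) (M : ℕ) : Prop where
  pos : ∀ m, M ≤ m → 0 < g m
  half_le : ∀ m, M ≤ m → 1 / 2 ≤ g m - oddsDown p (m + 1) * g (m + 1)
  le_two : ∀ m, M ≤ m → g m - oddsDown p (m + 1) * g (m + 1) ≤ 2

namespace IsGauge

variable {g : ℕ → ℝ} {M : ℕ}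

/-- 2g is a supersolution of the recursion for the resistances and is positive at n, where the
resistance vanishes; induct downwards from n. -/
theorem resistance_le (hg : IsGauge p g M) (hp : ∀ k : ℕ, 1 ≤ k → 0 ≤ p k ∧ p k < 1 / 2)
    {m n : ℕ} (hM : M ≤ m) (hmn : m ≤ n) : resistance p m n ≤ 2 * g m := by
  induction hmn using Nat.decreasingInduction with
  | self => rw [resistance_self]; linarith [hg.pos n hM]
  | of_succ k hk ih =>
    rw [resistance_eq_one_add hk]
    have h1 := mul_le_mul_of_nonneg_left (ih (by omega))
      (oddsDown_mem hp (Nat.le_add_left 1 k)).1.le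
    linarith [hg.half_le k hM]

/-- g/2 is a subsolution. Subtracting half the product times g(n), a solution of the homogeneous
recursion, makes it vanish at n. -/
theorem sub_le_resistance (hg : IsGauge p g M) (hp : ∀ k : ℕ, 1 ≤ k → 0 ≤ p k ∧ p k < 1 / 2)
    {m n : ℕ} (hM : M ≤ m) (hmn : m ≤ n) :
    (g m - (∏ i ∈ Finset.Ioc m n, oddsDown p i) * g n) / 2 ≤ resistance p m n := by
  induction hmn using Nat.decreasingInduction with
  | self => simp [resistance_self]
  | of_succ k hk ih =>
    rw [resistance_eq_one_add hk, prod_oddsDown_eq_mul hk]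
    have h1 := mul_le_mul_of_nonneg_left (ih (by omega))
      (oddsDown_mem hp (Nat.le_add_left 1 k)).1.le
    linarith [hg.le_two k hM]

/-- One step gives ρ_{n+1} g(n+1) ≤ g(n) - 1/2 = g(n)(1 - 1/(2g(n))), and 1 - x ≤ exp(-x). -/
theorem prod_oddsDown_mul_le (hg : IsGauge p g M)
    (hp : ∀ k : ℕ, 1 ≤ k → 0 ≤ p k ∧ p k < 1 / 2) {m n : ℕ} (hM : M ≤ m) (hmn : m ≤ n) :
    (∏ i ∈ Finset.Ioc m n, oddsDown p i) * g n ≤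
      g m * Real.exp (-∑ i ∈ Finset.Ico m n, (2 * g i)⁻¹) := by
  induction n, hmn using Nat.le_induction with
  | base => simp
  | succ n hmn ih =>
    have hgn := hg.pos n (by omega)
    have h1 : oddsDown p (n + 1) * g (n + 1) ≤ g n * Real.exp (-(2 * g n)⁻¹) := by
      have h2 := Real.add_one_le_exp (-(2 * g n)⁻¹)
      have h3 := mul_le_mul_of_nonneg_left h2 hgn.le
      have h4 : g n * (-(2 * g n)⁻¹ + 1) = g n - 1 / 2 := by field_simp; ring
      linarith [hg.half_le n (by omega)]
    rw [Finset.prod_Ioc_succ_top (by omega), Finset.sum_Ico_succ_top hmn, neg_add, Real.exp_add,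
      mul_assoc]
    calc (∏ i ∈ Finset.Ioc m n, oddsDown p i) * (oddsDown p (n + 1) * g (n + 1))
        ≤ (∏ i ∈ Finset.Ioc m n, oddsDown p i) * (g n * Real.exp (-(2 * g n)⁻¹)) :=
          mul_le_mul_of_nonneg_left h1 (prod_oddsDown_pos hp m n).le
      _ = ((∏ i ∈ Finset.Ioc m n, oddsDown p i) * g n) * Real.exp (-(2 * g n)⁻¹) := by ring
      _ ≤ (g m * Real.exp (-∑ i ∈ Finset.Ico m n, (2 * g i)⁻¹)) * Real.exp (-(2 * g n)⁻¹) :=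
          mul_le_mul_of_nonneg_right ih (Real.exp_pos _).le
      _ = _ := by ring

theorem le_resistance (hg : IsGauge p g M) (hp : ∀ k : ℕ, 1 ≤ k → 0 ≤ p k ∧ p k < 1 / 2)
    {m n : ℕ} (hM : M ≤ m) (hmn : m ≤ n) :
    g m / 2 * (1 - Real.exp (-∑ i ∈ Finset.Ico m n, (2 * g i)⁻¹)) ≤ resistance p m n := by
  have h1 := hg.sub_le_resistance hp hM hmn
  have h2 := hg.prod_oddsDown_mul_le hp hM hmn
  linarith

/-- The correction at n is reduced by a factor of at most exp(-1) ≤ 1/2, so at least g(m)/4 of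
resistance remains. -/
theorem inv_resistance_le_of_one_le_sum (hg : IsGauge p g M)
    (hp : ∀ k : ℕ, 1 ≤ k → 0 ≤ p k ∧ p k < 1 / 2) {m n : ℕ} (hM : M ≤ m) (hmn : m ≤ n)
    (hs : 1 ≤ ∑ i ∈ Finset.Ico m n, (2 * g i)⁻¹) : (resistance p m n)⁻¹ ≤ 4 / g m := by
  have hgm := hg.pos m hM
  have h1 := hg.le_resistance hp hM hmn
  have h2 : Real.exp (-∑ i ∈ Finset.Ico m n, (2 * g i)⁻¹) ≤ 1 / 2 := by
    refine (Real.exp_le_exp.2 (neg_le_neg hs)).trans ?_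
    rw [Real.exp_neg, one_div]
    exact inv_anti₀ (by norm_num) (by linarith [Real.add_one_le_exp (1 : ℝ)])
  have h3 : g m / 4 ≤ resistance p m n := by nlinarith
  calc (resistance p m n)⁻¹ ≤ (g m / 4)⁻¹ := inv_anti₀ (by positivity) h3
    _ = 4 / g m := by rw [inv_div]

/-- At distance at most `m` from `m`, the resistance is at least of the order of the minimum of the
distance and `g m`, if `g` is of order `g m` there. -/
theorem inv_resistance_le_of_le_two_mul (hg : IsGauge p g M)
    (hp : ∀ k : ℕ, 1 ≤ k → 0 ≤ p k ∧ p k < 1 / 2) {C : ℝ} (hC : 0 < C) {m n : ℕ} (hM : M ≤ m)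
    (hmn : m < n) (hgC : ∀ i, m ≤ i → i < n → g i ≤ C * g m) :
    (resistance p m n)⁻¹ ≤ 2 / g m + 4 * C / (n - m : ℝ) := by
  have hgm := hg.pos m hM
  have hd : (0 : ℝ) < n - m := by rw [sub_pos]; exact_mod_cast hmn
  set S := ∑ i ∈ Finset.Ico m n, (2 * g i)⁻¹ with hS
  have hS1 : (n - m : ℝ) / (2 * C * g m) ≤ S := by
    have := Finset.card_nsmul_le_sum (Finset.Ico m n) (fun i => (2 * g i)⁻¹) (2 * C * g m)⁻¹ ?_
    · rw [Nat.card_Ico, nsmul_eq_mul, Nat.cast_sub hmn.le] at this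
      rwa [div_eq_mul_inv]
    · intro i hi
      rw [Finset.mem_Ico] at hi
      have := hgC i hi.1 hi.2
      exact inv_anti₀ (by have := hg.pos i (by omega); positivity) (by linarith)
  have hS0 : 0 < S := lt_of_lt_of_le (by positivity) hS1
  have h1 := hg.le_resistance hp hM hmn.le
  -- The lower bound S/(1 + S) has inverse 1 + 1/S, which splits the estimate into a saturated term
  -- and a distance term.
  have h2 : S / (1 + S) ≤ 1 - Real.exp (-S) := by
    have h3 : Real.exp (-S) ≤ (1 + S)⁻¹ := by
      rw [Real.exp_neg]; exact inv_anti₀ (by positivity) (by linarith [Real.add_one_le_exp S])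
    have h4 : S / (1 + S) = 1 - (1 + S)⁻¹ := by field_simp; ring
    linarith
  have h5 : g m / 2 * (S / (1 + S)) ≤ resistance p m n :=
    (mul_le_mul_of_nonneg_left h2 (by positivity)).trans h1
  calc (resistance p m n)⁻¹ ≤ (g m / 2 * (S / (1 + S)))⁻¹ := inv_anti₀ (by positivity) h5
    _ = 2 / g m + 2 / g m * S⁻¹ := by field_simp; ring
    _ ≤ 2 / g m + 2 / g m * ((n - m : ℝ) / (2 * C * g m))⁻¹ := by gcongr
    _ = 2 / g m + 4 * C / (n - m : ℝ) := by field_simp; ring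

end IsGauge

end Comparison

/-! ### Asymptotics of the iterated logarithm gauge -/

/-- The site `m` times `(log log m) ^ β`. -/
noncomputable def logGauge (β : ℝ) (m : ℕ) : ℝ := m * Real.log (Real.log m) ^ β

theorem tendsto_loglog : Tendsto (fun x : ℝ => Real.log (Real.log x)) atTop atTop :=
  Real.tendsto_log_atTop.comp Real.tendsto_log_atTop

theorem tendsto_loglog_rpow_div_log (γ : ℝ) :
    Tendsto (fun x : ℝ => Real.log (Real.log x) ^ γ / Real.log x) atTop (nhds 0) := by
  have h := (isLittleO_log_rpow_rpow_atTop γ (zero_lt_one)).tendsto_div_nhds_zero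
  simp only [Real.rpow_one] at h
  exact h.comp Real.tendsto_log_atTop

theorem tendsto_loglog_rpow_div (γ : ℝ) :
    Tendsto (fun x : ℝ => Real.log (Real.log x) ^ γ / x) atTop (nhds 0) := by
  refine squeeze_zero' ?_ ?_ (tendsto_loglog_rpow_div_log γ)
  · filter_upwards [tendsto_loglog.eventually_ge_atTop 0, eventually_gt_atTop 0] with x h1 h2
    positivity
  · filter_upwards [tendsto_loglog.eventually_ge_atTop 0, eventually_gt_atTop 1] with x h1 h2
    have := Real.log_pos h2
    have := Real.log_le_sub_one_of_pos (show 0 < x by linarith)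
    gcongr
    linarith

/-- By the mean value theorem the increment is β (log log ξ)^(β-1) / (ξ log ξ) with ξ > x; the
factor x/ξ is at most 1 and the rest tends to 0. -/
theorem tendsto_mul_loglog_rpow_sub (β : ℝ) :
    Tendsto (fun x : ℝ => x * (Real.log (Real.log (x + 1)) ^ β - Real.log (Real.log x) ^ β)) atTop
      (nhds 0) := by
  have hlim : Tendsto (fun x : ℝ => |β| * (Real.log (Real.log x) ^ (β - 1) / Real.log x)) atTop
      (nhds 0) := by
    simpa using (tendsto_loglog_rpow_div_log (β - 1)).const_mul |β|
  rw [Metric.tendsto_nhds]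
  intro ε hε
  obtain ⟨T, hT⟩ := eventually_atTop.1 ((hlim.eventually_lt_const hε).and
    ((tendsto_loglog.eventually_gt_atTop 0).and (eventually_gt_atTop 1)))
  filter_upwards [eventually_ge_atTop T] with x hx
  have hder : ∀ t ∈ Set.Icc x (x + 1), HasDerivAt (fun t => Real.log (Real.log t) ^ β)
      (t⁻¹ / Real.log t * β * Real.log (Real.log t) ^ (β - 1)) t := by
    intro t ht
    obtain ⟨_, h2, h3⟩ := hT t (hx.trans ht.1)
    exact (((Real.hasDerivAt_log (by linarith)).log (Real.log_pos h3).ne').rpow_const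
      (Or.inl h2.ne'))
  obtain ⟨ξ, hξ, he⟩ := exists_hasDerivAt_eq_slope (fun t => Real.log (Real.log t) ^ β) _
    (show x < x + 1 by linarith) (fun t ht => (hder t ht).continuousAt.continuousWithinAt)
    fun t ht => hder t ⟨ht.1.le, ht.2.le⟩
  have hx1 := (hT x hx).2.2
  obtain ⟨h1, h2, h3⟩ := hT ξ (hx.trans hξ.1.le)
  rw [add_sub_cancel_left, div_one] at he
  have hl := Real.log_pos h3
  rw [dist_zero_right, ← he, Real.norm_eq_abs]
  have e : x * (ξ⁻¹ / Real.log ξ * β * Real.log (Real.log ξ) ^ (β - 1)) =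
      (x / ξ) * (β * (Real.log (Real.log ξ) ^ (β - 1) / Real.log ξ)) := by ring
  have hxξ : x / ξ ≤ 1 := (div_le_one (by linarith)).2 hξ.1.le
  have h0 : 0 ≤ Real.log (Real.log ξ) ^ (β - 1) / Real.log ξ := by positivity
  rw [e, abs_mul, abs_mul, abs_of_nonneg h0, abs_of_nonneg (by positivity)]
  refine lt_of_le_of_lt (mul_le_of_le_one_left (by positivity) hxξ) h1

/-- The probabilities in the theorem make `logGauge β` an asymptotic solution of the recursion. -/
theorem tendsto_logGauge_sub {β : ℝ} {p : ℕ → ℝ}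
    (hp : ∀ k : ℕ, 1 ≤ k → 0 ≤ p k ∧ p k < 1 / 2)
    (hpβ : ∀ᶠ k : ℕ in atTop,
      p k = 1 / 4 * (1 / (k : ℝ) + 1 / ((k : ℝ) * Real.log (Real.log (k : ℝ)) ^ β))) :
    Tendsto (fun m => logGauge β m - oddsDown p (m + 1) * logGauge β (m + 1)) atTop (nhds 1) := by
  have hcast : Tendsto (fun m : ℕ => (m : ℝ)) atTop atTop := tendsto_natCast_atTop_atTop
  have hsucc : Tendsto (fun m : ℕ => (m : ℝ) + 1) atTop atTop :=
    tendsto_atTop_add_const_right _ _ hcast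
  -- With p = `p (m + 1)`, x = m + 1 and A = (log log x)^β, r(x) = 2p(A + 1). By ρ = 1 - 4p + 8p²/(1
  -- + 2p) and 4pxA = A + 1, the quadratic term of ρ contributes r(x)/(1 + 2p) to ρ g(x).
  set r : ℝ → ℝ := fun x => (2 * (1 / x) + Real.log (Real.log x) ^ β / x +
    Real.log (Real.log x) ^ (-β) / x) / 2 with hr
  have hr0 : Tendsto r atTop (nhds 0) := by
    have h1 : Tendsto (fun x : ℝ => 1 / x) atTop (nhds 0) := by
      simpa using tendsto_inv_atTop_zero (𝕜 := ℝ)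
    have := (((h1.const_mul 2).add (tendsto_loglog_rpow_div β)).add
      (tendsto_loglog_rpow_div (-β))).div_const 2
    simpa only [mul_zero, add_zero, zero_div] using this
  set q : ℕ → ℝ := fun m => (1 + 2 * p (m + 1))⁻¹ with hq
  have hq1 : ∀ m, |q m| ≤ 1 := by
    intro m
    have := (hp (m + 1) (by omega)).1
    rw [abs_of_nonneg (by positivity)]
    exact inv_le_one_of_one_le₀ (by linarith)
  have herr : Tendsto (fun m : ℕ => q m * r ((m : ℝ) + 1)) atTop (nhds 0) := by
    refine squeeze_zero_norm (fun m => ?_) (tendsto_zero_iff_norm_tendsto_zero.1 (hr0.comp hsucc))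
    rw [norm_mul]
    exact mul_le_of_le_one_left (norm_nonneg _) (hq1 m)
  have hmain : Tendsto (fun m : ℕ => 1 - (m : ℝ) * (Real.log (Real.log ((m : ℝ) + 1)) ^ β -
      Real.log (Real.log (m : ℝ)) ^ β) - q m * r ((m : ℝ) + 1)) atTop (nhds 1) := by
    simpa using (((tendsto_mul_loglog_rpow_sub β).comp hcast).const_sub 1).sub herr
  refine hmain.congr' ?_
  filter_upwards [(tendsto_add_atTop_nat 1).eventually hpβ,
    (tendsto_loglog.comp hsucc).eventually_gt_atTop 0] with m hm hL
  have hp0 := (hp (m + 1) (by omega)).1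
  have hE : upProb p (m + 1) = 1 / 2 + p (m + 1) := by simp [upProb]
  have hx : (0 : ℝ) < (m : ℝ) + 1 := by positivity
  have hL' : 0 < Real.log (Real.log ((m : ℝ) + 1)) := hL
  have hA := Real.rpow_pos_of_pos hL' β
  push_cast at hm
  simp only [hr, hq, logGauge, oddsDown, hE]
  push_cast
  rw [Real.rpow_neg hL'.le]
  set A := Real.log (Real.log ((m : ℝ) + 1)) ^ β
  set x := (m : ℝ) + 1 with hxm
  have hm' : (m : ℝ) = x - 1 := by rw [hxm]; ring
  have hpx : 4 * p (m + 1) * (x * A) = A + 1 := by rw [hm]; field_simp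
  have hrp : (2 * (1 / x) + A / x + A⁻¹ / x) / 2 = 2 * p (m + 1) * (A + 1) := by
    rw [hm]; field_simp; ring
  rw [hrp, hm']
  have h12 : (1 + 2 * p (m + 1)) ≠ 0 := by linarith
  have hden : (1 - (1 / 2 + p (m + 1))) / (1 / 2 + p (m + 1)) =
      1 - 4 * p (m + 1) + 8 * p (m + 1) ^ 2 * (1 + 2 * p (m + 1))⁻¹ := by
    have : (1 / 2 + p (m + 1)) ≠ 0 := by linarith
    field_simp; ring
  rw [hden]
  linear_combination (-1 + 2 * p (m + 1) * (1 + 2 * p (m + 1))⁻¹) * hpx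

theorem exists_isGauge {β : ℝ} {p : ℕ → ℝ} (hp : ∀ k : ℕ, 1 ≤ k → 0 ≤ p k ∧ p k < 1 / 2)
    (hpβ : ∀ᶠ k : ℕ in atTop,
      p k = 1 / 4 * (1 / (k : ℝ) + 1 / ((k : ℝ) * Real.log (Real.log (k : ℝ)) ^ β))) :
    ∃ M, IsGauge p (logGauge β) M := by
  have h := tendsto_logGauge_sub hp hpβ
  obtain ⟨M, hM⟩ := eventually_atTop.1 ((h.eventually_const_le (show (1 / 2 : ℝ) < 1 by norm_num)).and
    ((h.eventually_le_const (show (1 : ℝ) < 2 by norm_num)).and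
      (((tendsto_loglog.comp tendsto_natCast_atTop_atTop).eventually_gt_atTop 0).and
        (eventually_gt_atTop 0))))
  refine ⟨M, fun m hm => ?_, fun m hm => (hM m hm).1, fun m hm => (hM m hm).2.1⟩
  obtain ⟨_, _, h1, h2⟩ := hM m hm
  exact mul_pos (by exact_mod_cast h2) (Real.rpow_pos_of_pos h1 β)

theorem log_add_one_sub_log_le {x : ℝ} (hx : 0 < x) : Real.log (x + 1) - Real.log x ≤ x⁻¹ := by
  rw [← Real.log_div (by linarith) hx.ne']
  refine (Real.log_le_sub_one_of_pos (by positivity)).trans (le_of_eq ?_)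
  field_simp; ring

theorem log_sub_log_le_sum_inv {m n : ℕ} (hm : 0 < m) (hmn : m ≤ n) :
    Real.log n - Real.log m ≤ ∑ i ∈ Finset.Ico m n, (i : ℝ)⁻¹ := by
  rw [← Finset.sum_Ico_sub (fun i : ℕ => Real.log i) hmn]
  refine Finset.sum_le_sum fun i hi => ?_
  have h0 : (0 : ℝ) < i := by exact_mod_cast hm.trans_le (Finset.mem_Ico.1 hi).1
  push_cast
  exact log_add_one_sub_log_le h0

/-- Between `m` and `m ^ 2`, the iterated logarithm at most doubles. -/
theorem eventually_loglog_bounds : ∀ᶠ m : ℕ in atTop, 1 ≤ Real.log (Real.log m) ∧ 3 ≤ m ∧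
    1 ≤ Real.log m ∧ ∀ i : ℕ, m ≤ i → Real.log (Real.log m) ≤ Real.log (Real.log i) ∧
      (i ≤ m ^ 2 → Real.log (Real.log i) ≤ 2 * Real.log (Real.log m)) := by
  filter_upwards [(tendsto_loglog.comp tendsto_natCast_atTop_atTop).eventually_ge_atTop 1,
    (Real.tendsto_log_atTop.comp tendsto_natCast_atTop_atTop).eventually_ge_atTop 1,
    eventually_ge_atTop 3] with m h1 h2 h3
  change 1 ≤ Real.log (Real.log m) at h1
  change 1 ≤ Real.log m at h2
  refine ⟨h1, h3, h2, fun i hi => ?_⟩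
  have hm0 : (0 : ℝ) < m := by exact_mod_cast (show 0 < m by omega)
  have hmi : (m : ℝ) ≤ i := by exact_mod_cast hi
  have hl := Real.log_le_log hm0 hmi
  refine ⟨Real.log_le_log (by linarith) hl, fun hi2 => ?_⟩
  have h4 : Real.log i ≤ 2 * Real.log m := by
    have : (i : ℝ) ≤ (m : ℝ) ^ 2 := by exact_mod_cast hi2
    have := Real.log_le_log (hm0.trans_le hmi) this
    rwa [Real.log_pow] at this
  -- log(2 log m) = log 2 + log log m, and log 2 < 1 ≤ log log m.
  have h5 := Real.log_le_log (by linarith) h4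
  rw [Real.log_mul (by norm_num) (by linarith)] at h5
  linarith [Real.log_two_lt_d9]

theorem rpow_le_two_rpow_mul {a b β : ℝ} (ha : 0 < a) (hab : a ≤ b) (hb : b ≤ 2 * a) :
    b ^ β ≤ 2 ^ |β| * a ^ β := by
  rcases le_or_gt 0 β with h | h
  · rw [abs_of_nonneg h, ← Real.mul_rpow (by norm_num) ha.le]
    exact Real.rpow_le_rpow (by linarith) hb h
  · refine (Real.rpow_le_rpow_of_nonpos ha hab h.le).trans ?_
    exact le_mul_of_one_le_left (by positivity)
      (Real.one_le_rpow (by norm_num) (abs_nonneg β))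

theorem eventually_logGauge_le (β : ℝ) : ∀ᶠ m : ℕ in atTop, ∀ i, m ≤ i → i ≤ 2 * m →
    logGauge β i ≤ (2 * 2 ^ |β|) * logGauge β m := by
  filter_upwards [eventually_loglog_bounds] with m ⟨h1, h3, _, h⟩ i hi hi2
  obtain ⟨h4, h5⟩ := h i hi
  have h6 := rpow_le_two_rpow_mul (β := β) (by linarith) h4 (h5 (by nlinarith))
  have h7 : (i : ℝ) ≤ 2 * m := by exact_mod_cast hi2
  have : 0 ≤ Real.log (Real.log i) ^ β := Real.rpow_nonneg (by linarith) _
  calc logGauge β i ≤ (2 * m) * (2 ^ |β| * Real.log (Real.log m) ^ β) :=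
        mul_le_mul h7 h6 this (by positivity)
    _ = (2 * 2 ^ |β|) * logGauge β m := by rw [logGauge]; ring

/-- The sum of 1/i from m to m^2 is at least log m, which outgrows any power of log log m. So the
resistance from m is saturated beyond m^2. -/
theorem eventually_one_le_sum_inv_logGauge (β : ℝ) : ∀ᶠ m : ℕ in atTop, ∀ n, m ^ 2 ≤ n →
    1 ≤ ∑ i ∈ Finset.Ico m n, (2 * logGauge β i)⁻¹ := by
  have hlim := ((tendsto_loglog_rpow_div_log |β|).comp
    tendsto_natCast_atTop_atTop).eventually_le_const
      (show (0 : ℝ) < (2 * 2 ^ |β|)⁻¹ by positivity)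
  filter_upwards [eventually_loglog_bounds, hlim] with m ⟨h1, h3, hl, h⟩ hlim n hn
  change Real.log (Real.log m) ^ |β| / Real.log m ≤ (2 * 2 ^ |β|)⁻¹ at hlim
  set A := 2 ^ |β| * Real.log (Real.log m) ^ |β| with hA
  have hA0 : 0 < A := mul_pos (by positivity) (Real.rpow_pos_of_pos (by linarith) _)
  have hmm : m ≤ m ^ 2 := by nlinarith
  have hterm : ∀ i ∈ Finset.Ico m (m ^ 2), (2 * A)⁻¹ * (i : ℝ)⁻¹ ≤ (2 * logGauge β i)⁻¹ := by
    intro i hi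
    rw [Finset.mem_Ico] at hi
    obtain ⟨h4, h5⟩ := h i hi.1
    have hL1 : 1 ≤ Real.log (Real.log i) := h1.trans h4
    have h6 : Real.log (Real.log i) ^ β ≤ A :=
      (Real.rpow_le_rpow_of_exponent_le hL1 (le_abs_self β)).trans
        ((rpow_le_two_rpow_mul (by linarith) h4 (h5 hi.2.le)).trans_eq (by rw [abs_abs]))
    have hi0 : (0 : ℝ) < i := by exact_mod_cast (show 0 < i by omega)
    have hp0 : 0 < Real.log (Real.log i) ^ β := Real.rpow_pos_of_pos (by linarith) _
    rw [← mul_inv, logGauge]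
    refine inv_anti₀ (by positivity) ?_
    have := mul_le_mul_of_nonneg_left h6 hi0.le
    linarith
  have hsum : ∑ i ∈ Finset.Ico m (m ^ 2), (2 * logGauge β i)⁻¹ ≤
      ∑ i ∈ Finset.Ico m n, (2 * logGauge β i)⁻¹ := by
    refine Finset.sum_le_sum_of_subset_of_nonneg (Finset.Ico_subset_Ico_right hn) fun i hi _ => ?_
    have h4 := (h i (Finset.mem_Ico.1 hi).1).1
    have : 0 ≤ Real.log (Real.log i) ^ β := Real.rpow_nonneg (by linarith) _
    rw [logGauge]
    positivity
  have hlog := log_sub_log_le_sum_inv (show 0 < m by omega) hmm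
  rw [Nat.cast_pow, Real.log_pow] at hlog
  have h7 : 1 ≤ (2 * A)⁻¹ * Real.log m := by
    rw [div_le_iff₀ (by linarith), ← div_eq_inv_mul, le_div_iff₀ (by positivity)] at hlim
    rw [← div_eq_inv_mul, le_div_iff₀ (by positivity), hA]
    linarith
  calc (1 : ℝ) ≤ (2 * A)⁻¹ * Real.log m := h7
    _ ≤ (2 * A)⁻¹ * ∑ i ∈ Finset.Ico m (m ^ 2), (i : ℝ)⁻¹ := by
        refine mul_le_mul_of_nonneg_left ?_ (by positivity)
        push_cast at hlog
        linarith
    _ ≤ ∑ i ∈ Finset.Ico m (m ^ 2), (2 * logGauge β i)⁻¹ := by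
        rw [Finset.mul_sum]; exact Finset.sum_le_sum hterm
    _ ≤ _ := hsum

/-! ### Escape probabilities and the two series -/

namespace IsWalkFamily

variable {p : ℕ → ℝ} {Q : ℕ → Measure (ℕ → ℕ)}

theorem le_real_stayAbove (hQ : IsWalkFamily p Q)
    (hp : ∀ k : ℕ, 1 ≤ k → 0 ≤ p k ∧ p k < 1 / 2) {g : ℕ → ℝ} {M : ℕ} (hg : IsGauge p g M)
    {m : ℕ} (hm : M ≤ m) : (2 * g m)⁻¹ ≤ (Q (m + 1)).real (stayAbove m) := by
  refine ge_of_tendsto (hQ.tendsto_inv_resistance hp m) ?_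
  filter_upwards [eventually_gt_atTop m] with n hn
  exact inv_anti₀ (by linarith [one_le_resistance hp hn]) (hg.resistance_le hp hm hn.le)

theorem eventually_real_stayAbove_le (hQ : IsWalkFamily p Q)
    (hp : ∀ k : ℕ, 1 ≤ k → 0 ≤ p k ∧ p k < 1 / 2) {β : ℝ} {M : ℕ}
    (hg : IsGauge p (logGauge β) M) :
    ∀ᶠ m in atTop, (Q (m + 1)).real (stayAbove m) ≤ 4 / logGauge β m := by
  filter_upwards [eventually_one_le_sum_inv_logGauge β, eventually_ge_atTop M] with m h hm
  refine le_of_tendsto (hQ.tendsto_inv_resistance hp m) ?_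
  filter_upwards [eventually_ge_atTop (m ^ 2), eventually_ge_atTop m] with n hn hn'
  exact hg.inv_resistance_le_of_one_le_sum hp hm hn' (h n hn)

end IsWalkFamily

/-- Cauchy condensation reduces this to the sum of k^(-β). -/
theorem summable_inv_mul_log_rpow {β : ℝ} (hβ : 1 < β) :
    Summable fun k : ℕ => ((k : ℝ) * Real.log (k + 1) ^ β)⁻¹ := by
  have hlog : ∀ k : ℕ, 0 ≤ Real.log ((k : ℝ) + 1) := fun k => Real.log_nonneg (by simp)
  rw [← summable_condensed_iff_of_nonneg]
  · have hs : Summable fun k : ℕ => (Real.log 2 ^ β)⁻¹ * ((k : ℝ) ^ β)⁻¹ :=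
      (Real.summable_nat_rpow_inv.2 hβ).mul_left _
    refine Summable.of_norm_bounded_eventually_nat hs ?_
    filter_upwards [eventually_ge_atTop 1] with k hk
    have hk' : (0 : ℝ) < k := by exact_mod_cast hk
    have hl2 : 0 < Real.log 2 := Real.log_pos (by norm_num)
    have h1 : (k : ℝ) * Real.log 2 ≤ Real.log (((2 ^ k : ℕ) : ℝ) + 1) := by
      rw [← Real.log_pow]
      exact Real.log_le_log (by positivity) (by push_cast; linarith)
    have h2 := Real.rpow_le_rpow (by positivity) h1 (by linarith : (0 : ℝ) ≤ β)
    rw [Real.mul_rpow hk'.le hl2.le] at h2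
    have h3 : 0 < (k : ℝ) ^ β * Real.log 2 ^ β := by positivity
    rw [Real.norm_of_nonneg (by have := hlog (2 ^ k); positivity), mul_inv, ← mul_assoc]
    push_cast at h2 ⊢
    rw [mul_inv_cancel₀ (by positivity), one_mul, ← mul_inv, mul_comm (Real.log 2 ^ β)]
    exact inv_anti₀ h3 h2
  · intro k
    have := hlog k
    positivity
  · intro m n hm hmn
    have hm' : (0 : ℝ) < m := by exact_mod_cast hm
    have hmn' : (m : ℝ) ≤ n := by exact_mod_cast hmn
    have hl : 0 < Real.log ((m : ℝ) + 1) := Real.log_pos (by linarith)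
    have := Real.log_le_log (show (0 : ℝ) < (m : ℝ) + 1 by linarith)
      (show (m : ℝ) + 1 ≤ n + 1 by linarith)
    refine inv_anti₀ (by positivity) ?_
    gcongr

/-- The series of the block probabilities converges for `β > 1`. -/
theorem summable_sum_Ico_div {β : ℝ} (hβ : 1 < β) {v : ℕ → ℝ} (hv0 : ∀ m, 0 ≤ v m)
    (hv : ∀ᶠ m in atTop, v m ≤ 4 / logGauge β m) :
    Summable fun k : ℕ => (∑ m ∈ Finset.Ico (2 ^ k) (2 ^ (k + 2)), v m) / (k : ℝ) := by
  have hpow : Tendsto (fun k : ℕ => 2 ^ k) atTop atTop :=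
    tendsto_pow_atTop_atTop_of_one_lt (by norm_num)
  obtain ⟨M, hM⟩ := eventually_atTop.1 (hv.and eventually_loglog_bounds)
  refine Summable.of_norm_bounded_eventually_nat
    ((summable_inv_mul_log_rpow hβ).mul_left (12 * 2 ^ β)) ?_
  filter_upwards [hpow.eventually_ge_atTop M, eventually_ge_atTop 4] with k hk hk4
  have hk' : (4 : ℝ) ≤ k := by exact_mod_cast hk4
  have hl1 : 0 < Real.log ((k : ℝ) + 1) := Real.log_pos (by linarith)
  -- log log 2^k = log(k log 2), and k + 1 ≤ (k log 2)^2 for k ≥ 4.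
  have hsq : Real.log ((k : ℝ) + 1) / 2 ≤ Real.log (Real.log ((2 ^ k : ℕ) : ℝ)) := by
    push_cast
    rw [Real.log_pow, div_le_iff₀ (by norm_num)]
    have h1 : (k : ℝ) + 1 ≤ (k * Real.log 2) ^ 2 := by
      have h2 : (0.69 : ℝ) ≤ Real.log 2 := by linarith [Real.log_two_gt_d9]
      have h3 : (k : ℝ) * 0.69 ≤ k * Real.log 2 := by gcongr
      nlinarith
    have h2 := Real.log_le_log (by linarith) h1
    rw [Real.log_pow] at h2
    push_cast at h2
    linarith
  set A := (Real.log ((k : ℝ) + 1) / 2) ^ β with hA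
  have hA0 : 0 < A := by positivity
  have hterm : ∀ m ∈ Finset.Ico (2 ^ k) (2 ^ (k + 2)), v m ≤ 4 / ((2 : ℝ) ^ k * A) := by
    intro m hm
    rw [Finset.mem_Ico] at hm
    obtain ⟨h1, _⟩ := hM m (hk.trans hm.1)
    refine h1.trans ?_
    have h2 := (hM (2 ^ k) hk).2.2.2.2 m hm.1
    have h3 : (2 : ℝ) ^ k ≤ m := by exact_mod_cast hm.1
    rw [logGauge]
    gcongr
    exact Real.rpow_le_rpow (by positivity) (hsq.trans h2.1) (by linarith)
  have hsum := Finset.sum_le_card_nsmul _ _ _ hterm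
  have hcard : ((2 ^ (k + 2) - 2 ^ k : ℕ) : ℝ) = 3 * 2 ^ k := by
    rw [show 2 ^ (k + 2) - 2 ^ k = 3 * 2 ^ k by rw [pow_add]; omega]; push_cast; ring
  rw [Nat.card_Ico, nsmul_eq_mul, hcard] at hsum
  rw [Real.norm_of_nonneg (div_nonneg (Finset.sum_nonneg fun m _ => hv0 m) (by linarith))]
  calc (∑ m ∈ Finset.Ico (2 ^ k) (2 ^ (k + 2)), v m) / (k : ℝ)
      ≤ (3 * 2 ^ k * (4 / ((2 : ℝ) ^ k * A))) / k := by gcongr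
    _ = 12 * 2 ^ β * ((k : ℝ) * Real.log (k + 1) ^ β)⁻¹ := by
        rw [hA, Real.div_rpow hl1.le (by norm_num)]; field_simp; norm_num

/-- The mean weighted number of strong cutpoints diverges for `β ≤ 1`. -/
theorem tendsto_sum_inv_log_mul_logGauge {β : ℝ} (hβ : β ≤ 1) {M : ℕ}
    (hM : 1 ≤ Real.log (Real.log M) ∧ 3 ≤ M ∧ 1 ≤ Real.log M ∧
      ∀ i : ℕ, M ≤ i → Real.log (Real.log M) ≤ Real.log (Real.log i)) :
    Tendsto (fun n => ∑ m ∈ Finset.Ico M n, (Real.log m * logGauge β m)⁻¹) atTop atTop := by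
  obtain ⟨h1, h3, h2, h⟩ := hM
  have hlim : Tendsto (fun n : ℕ => Real.log (Real.log (Real.log n)) -
      Real.log (Real.log (Real.log M))) atTop atTop :=
    tendsto_atTop_add_const_right _ _
      (Real.tendsto_log_atTop.comp (tendsto_loglog.comp tendsto_natCast_atTop_atTop))
  refine tendsto_atTop_mono' _ ?_ hlim
  filter_upwards [eventually_ge_atTop M] with n hn
  -- The triple logarithm telescopes; each of its increments is bounded by applying log b - log a ≤
  -- (b - a)/a three times.
  rw [← Finset.sum_Ico_sub (fun i : ℕ => Real.log (Real.log (Real.log i))) hn]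
  refine Finset.sum_le_sum fun i hi => ?_
  rw [Finset.mem_Ico] at hi
  have hL := h1.trans (h i hi.1)
  have hi0 : (0 : ℝ) < i := by exact_mod_cast (show 0 < i by omega)
  have hl : 0 < Real.log i := by
    have hM0 : (0 : ℝ) < M := by exact_mod_cast (show 0 < M by omega)
    linarith [Real.log_le_log hM0 (show (M : ℝ) ≤ i by exact_mod_cast hi.1)]
  have sub_le : ∀ a b : ℝ, 0 < a → 0 < b → Real.log b - Real.log a ≤ (b - a) / a := by
    intro a b ha hb
    rw [← Real.log_div hb.ne' ha.ne']
    refine (Real.log_le_sub_one_of_pos (by positivity)).trans (le_of_eq ?_)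
    field_simp
  have hl' : Real.log i ≤ Real.log ((i : ℝ) + 1) := Real.log_le_log hi0 (by linarith)
  have hL' : Real.log (Real.log i) ≤ Real.log (Real.log ((i : ℝ) + 1)) := Real.log_le_log hl hl'
  have e1 := sub_le (i : ℝ) (i + 1) hi0 (by linarith)
  have e2 := sub_le _ _ hl (hl.trans_le hl')
  have e3 := sub_le (Real.log (Real.log i)) (Real.log (Real.log ((i : ℝ) + 1))) (by linarith)
    (by linarith)
  -- This is where β ≤ 1 enters.
  have hA : Real.log (Real.log i) ^ β ≤ Real.log (Real.log i) := by
    simpa using Real.rpow_le_rpow_of_exponent_le hL hβ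
  have hA0 : 0 < Real.log (Real.log i) ^ β := Real.rpow_pos_of_pos (by linarith) _
  push_cast
  calc Real.log (Real.log (Real.log ((i : ℝ) + 1))) - Real.log (Real.log (Real.log i))
      ≤ (Real.log (Real.log ((i : ℝ) + 1)) - Real.log (Real.log i)) / Real.log (Real.log i) := e3
    _ ≤ ((Real.log ((i : ℝ) + 1) - Real.log i) / Real.log i) / Real.log (Real.log i) := by gcongr
    _ ≤ ((((i : ℝ) + 1 - i) / i) / Real.log i) / Real.log (Real.log i) := by gcongr
    _ = (Real.log i * (i * Real.log (Real.log i)))⁻¹ := by field_simp; ring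
    _ ≤ (Real.log i * logGauge β i)⁻¹ := by
        rw [logGauge]
        exact inv_anti₀ (by positivity) (by gcongr)

theorem sum_Ico_inv_sub_add_inv_le {M j : ℕ} (hM : 1 ≤ M) :
    ∑ i ∈ Finset.Ico M j, (((j : ℝ) - i)⁻¹ + (i : ℝ)⁻¹) ≤ 2 * (1 + Real.log j) := by
  have h1 : ∑ i ∈ Finset.Ico M j, (i : ℝ)⁻¹ ≤ (harmonic j : ℝ) := by
    have e : (harmonic j : ℝ) = ∑ i ∈ Finset.Ico 1 (j + 1), (i : ℝ)⁻¹ := by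
      rw [harmonic, Finset.sum_Ico_eq_sum_range]
      push_cast
      exact Finset.sum_congr rfl fun i _ => by rw [add_comm]
    rw [e]
    exact Finset.sum_le_sum_of_subset_of_nonneg (Finset.Ico_subset_Ico hM (Nat.le_succ j))
      fun i _ _ => by positivity
  have h2 : ∑ i ∈ Finset.Ico M j, ((j : ℝ) - i)⁻¹ ≤ (harmonic j : ℝ) := by
    have e : (harmonic j : ℝ) = ∑ i ∈ Finset.range j, ((j : ℝ) - i)⁻¹ := by
      rw [harmonic, ← Finset.sum_range_reflect]
      push_cast
      refine Finset.sum_congr rfl fun i hi => ?_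
      have hi : i < j := Finset.mem_range.1 hi
      rw [Nat.sub_sub, Nat.cast_sub (by omega)]
      push_cast
      congr 1; ring
    rw [e, Finset.range_eq_Ico]
    refine Finset.sum_le_sum_of_subset_of_nonneg (Finset.Ico_subset_Ico_left (Nat.zero_le M))
      fun i hi _ => ?_
    have : (i : ℝ) ≤ j := by exact_mod_cast (Finset.mem_Ico.1 hi).2.le
    exact inv_nonneg.2 (by linarith)
  rw [Finset.sum_add_distrib]
  have := harmonic_le_one_add_log j
  linarith

/-! ### Strong cutpoints with probability bounded below -/

namespace IsWalkFamily

variable {p : ℕ → ℝ} {Q : ℕ → Measure (ℕ → ℕ)}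

theorem inv_logGauge_le_real_strongCut (hQ : IsWalkFamily p Q)
    (hp : ∀ k : ℕ, 1 ≤ k → 0 ≤ p k ∧ p k < 1 / 2) {g : ℕ → ℝ} {M : ℕ} (hg : IsGauge p g M)
    {m : ℕ} (hm : M ≤ m) : (g m)⁻¹ ≤ 4 * (Q 0).real (strongCut m) := by
  have h1 := hQ.le_real_stayAbove hp hg hm
  have h2 : 1 / 2 ≤ upProb p m := by
    unfold upProb
    split_ifs with h
    · norm_num
    · linarith [(hp m (Nat.one_le_iff_ne_zero.2 h)).1]
  rw [hQ.real_strongCut hp]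
  rw [mul_inv] at h1
  nlinarith [measureReal_nonneg (μ := Q (m + 1)) (s := stayAbove m)]

/-- Strong cutpoints beyond `M` have a probability that is bounded below, by the second moment
method with the weights `1 / log m`. -/
theorem eventually_le_real_biUnion_strongCut (hQ : IsWalkFamily p Q)
    (hp : ∀ k : ℕ, 1 ≤ k → 0 ≤ p k ∧ p k < 1 / 2) {β : ℝ} (hβ : β ≤ 1) {M₀ : ℕ}
    (hg : IsGauge p (logGauge β) M₀) :
    ∃ c > 0, ∀ᶠ M in atTop, ∃ F : Finset ℕ, (∀ m ∈ F, M ≤ m) ∧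
      c ≤ (Q 0).real (⋃ m ∈ F, strongCut m) := by
  have := hQ.prob
  set C : ℝ := 2 * 2 ^ |β| with hC
  have hC0 : 0 < C := by positivity
  obtain ⟨M₁, hM₁⟩ := eventually_atTop.1 (eventually_loglog_bounds.and
    ((eventually_logGauge_le β).and (eventually_one_le_sum_inv_logGauge β)))
  -- Off-diagonal pairs contribute at most 2(24S + 32C)S and the diagonal at most S; for S ≥ 1 the
  -- total is at most (49 + 64C)S².
  refine ⟨(49 + 64 * C)⁻¹, by positivity, ?_⟩
  filter_upwards [eventually_ge_atTop M₀, eventually_ge_atTop M₁] with M hM0 hM1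
  set w : ℕ → ℝ := fun m => (Real.log m)⁻¹ with hw
  set b : ℕ → ℝ := fun m => (Q 0).real (strongCut m) with hb
  have hb0 : ∀ m, 0 ≤ b m := fun m => measureReal_nonneg
  have hlog : ∀ m, M ≤ m → 1 ≤ Real.log m := fun m hm => (hM₁ m (by omega)).1.2.2.1
  have hw0 : ∀ m, M ≤ m → 0 < w m ∧ w m ≤ 1 := fun m hm =>
    ⟨inv_pos.2 (by linarith [hlog m hm]), inv_le_one_of_one_le₀ (hlog m hm)⟩
  have hgb : ∀ m, M ≤ m → (logGauge β m)⁻¹ ≤ 4 * b m := fun m hm =>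
    hQ.inv_logGauge_le_real_strongCut hp hg (by omega)
  -- The threshold 4 for the gauge series compensates the factor 4 in `hgb`, so that the weighted
  -- mean is at least 1.
  obtain ⟨N, hN⟩ : ∃ N, 1 ≤ ∑ m ∈ Finset.Ico M N, w m * b m := by
    obtain ⟨h1, h2, h3, h4⟩ := (hM₁ M hM1).1
    have hlim := tendsto_sum_inv_log_mul_logGauge hβ ⟨h1, h2, h3, fun i hi => (h4 i hi).1⟩
    obtain ⟨N, hN⟩ := (hlim.eventually_ge_atTop 4).exists
    refine ⟨N, ?_⟩
    have : ∑ m ∈ Finset.Ico M N, (Real.log m * logGauge β m)⁻¹ ≤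
        ∑ m ∈ Finset.Ico M N, 4 * (w m * b m) := by
      refine Finset.sum_le_sum fun m hm => ?_
      have hm := (Finset.mem_Ico.1 hm).1
      rw [mul_inv]
      have := mul_le_mul_of_nonneg_left (hgb m hm) (hw0 m hm).1.le
      linarith
    rw [← Finset.mul_sum] at this
    linarith
  refine ⟨Finset.Ico M N, fun m hm => (Finset.mem_Ico.1 hm).1, ?_⟩
  set F := Finset.Ico M N with hF
  set S := ∑ m ∈ F, w m * b m with hS
  -- For j < i^2 the weights satisfy w i ≤ 2 w j. The distance bound applies up to j = 2i; beyond
  -- that monotonicity of the resistance leaves the term 1/i. For j ≥ i^2 the resistance is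
  -- saturated and only the gauge term remains.
  have hinv : ∀ i j, M ≤ i → i < j → w i * (resistance p i j)⁻¹ ≤
      6 * (w i * (logGauge β i)⁻¹) + 8 * C * w j * (((j : ℝ) - i)⁻¹ + (i : ℝ)⁻¹) := by
    intro i j hi hij
    have hgi := hg.pos i (by omega)
    have hwi := hw0 i hi
    have hwj := hw0 j (by omega)
    have hij' : (0 : ℝ) < j - i := by rw [sub_pos]; exact_mod_cast hij
    obtain ⟨hl, hdouble, hfar⟩ := hM₁ i (by omega)
    have hi0 : (0 : ℝ) < i := by have := hl.2.1; exact_mod_cast (show 0 < i by omega)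
    rcases Nat.lt_or_ge j (i ^ 2) with hj | hj
    · have h1 : (resistance p i j)⁻¹ ≤
          2 * (logGauge β i)⁻¹ + 4 * C * (((j : ℝ) - i)⁻¹ + (i : ℝ)⁻¹) := by
        rcases Nat.lt_or_ge (2 * i) j with h2 | h2
        · have h3 := hg.inv_resistance_le_of_le_two_mul hp hC0 (n := 2 * i) (show M₀ ≤ i by omega)
            (by omega) fun k hk hk' => hdouble k hk (by omega)
          have h4 : (resistance p i j)⁻¹ ≤ (resistance p i (2 * i))⁻¹ :=
            inv_anti₀ (by linarith [one_le_resistance hp (show i < 2 * i by omega)])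
              (resistance_mono hp i h2.le)
          have h5 : ((2 * i : ℕ) : ℝ) - i = i := by push_cast; ring
          rw [h5, div_eq_mul_inv, div_eq_mul_inv] at h3
          have h6 : 0 ≤ 4 * C * ((j : ℝ) - i)⁻¹ := by positivity
          linarith
        · have h3 := hg.inv_resistance_le_of_le_two_mul hp hC0 (show M₀ ≤ i by omega) hij
            fun k hk hk' => hdouble k hk (by omega)
          rw [div_eq_mul_inv, div_eq_mul_inv] at h3
          have h6 : 0 ≤ 4 * C * (i : ℝ)⁻¹ := by positivity
          linarith
      have h2 : w i ≤ 2 * w j := by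
        have h3 : Real.log j ≤ 2 * Real.log i := by
          have : (j : ℝ) ≤ (i : ℝ) ^ 2 := by exact_mod_cast hj.le
          have := Real.log_le_log (by linarith) this
          rwa [Real.log_pow] at this
        have h4 := hlog i hi
        have h5 := hlog j (by omega)
        simp only [hw]
        rw [← div_eq_mul_inv, inv_eq_one_div, div_le_div_iff₀ (by linarith) (by linarith)]
        linarith
      calc w i * (resistance p i j)⁻¹
          ≤ w i * (2 * (logGauge β i)⁻¹ + 4 * C * (((j : ℝ) - i)⁻¹ + (i : ℝ)⁻¹)) :=
            mul_le_mul_of_nonneg_left h1 hwi.1.le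
        _ = 2 * (w i * (logGauge β i)⁻¹) + w i * (4 * C * (((j : ℝ) - i)⁻¹ + (i : ℝ)⁻¹)) := by ring
        _ ≤ 6 * (w i * (logGauge β i)⁻¹) +
            (2 * w j) * (4 * C * (((j : ℝ) - i)⁻¹ + (i : ℝ)⁻¹)) := by
            have : 0 ≤ w i * (logGauge β i)⁻¹ := mul_nonneg hwi.1.le (inv_nonneg.2 hgi.le)
            gcongr
            linarith
        _ = _ := by ring
    · have h1 := hg.inv_resistance_le_of_one_le_sum hp (show M₀ ≤ i by omega) hij.le (hfar j hj)
      rw [div_eq_mul_inv] at h1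
      have h2 := mul_le_mul_of_nonneg_left h1 hwi.1.le
      have h3 : 0 ≤ w i * (logGauge β i)⁻¹ := mul_nonneg hwi.1.le (inv_nonneg.2 hgi.le)
      have h4 : 0 ≤ 8 * C * w j * (((j : ℝ) - i)⁻¹ + (i : ℝ)⁻¹) :=
        mul_nonneg (mul_nonneg (by positivity) hwj.1.le) (by positivity)
      linarith
  -- The gauge terms sum to at most 6 · 4 S. The distance terms sum to at most 8C w j · 2(1 + log
  -- j), and w j = 1/log j ≤ 1 cancels the logarithm.
  have hinner : ∀ j ∈ F, ∑ i ∈ Finset.Ico M j, w i * (resistance p i j)⁻¹ ≤ 24 * S + 32 * C := by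
    intro j hj
    rw [hF, Finset.mem_Ico] at hj
    have h1 : ∑ i ∈ Finset.Ico M j, 6 * (w i * (logGauge β i)⁻¹) ≤ 24 * S := by
      rw [hS, Finset.mul_sum]
      refine (Finset.sum_le_sum fun i hi => ?_).trans
        (Finset.sum_le_sum_of_subset_of_nonneg (Finset.Ico_subset_Ico_right hj.2.le)
          fun i hi _ => ?_)
      · have hi := (Finset.mem_Ico.1 hi).1
        have := mul_le_mul_of_nonneg_left (hgb i hi) (hw0 i hi).1.le
        linarith
      · have := mul_nonneg (hw0 i (Finset.mem_Ico.1 hi).1).1.le (hb0 i)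
        linarith
    have h2 : ∑ i ∈ Finset.Ico M j, 8 * C * w j * (((j : ℝ) - i)⁻¹ + (i : ℝ)⁻¹) ≤ 32 * C := by
      rw [← Finset.mul_sum]
      have hM3 : 1 ≤ M := by have := (hM₁ M hM1).1.2.1; omega
      have hwj := hw0 j hj.1
      have h3 := mul_le_mul_of_nonneg_left (sum_Ico_inv_sub_add_inv_le (j := j) hM3)
        (mul_nonneg (by positivity : 0 ≤ 8 * C) hwj.1.le)
      have h4 : w j * Real.log j = 1 := inv_mul_cancel₀ (by linarith [hlog j hj.1])
      have h5 : 8 * C * w j * (2 * (1 + Real.log j)) = 16 * C * w j + 16 * C := by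
        linear_combination (16 * C) * h4
      have h6 := mul_le_mul_of_nonneg_left hwj.2 (by positivity : 0 ≤ 16 * C)
      linarith
    calc ∑ i ∈ Finset.Ico M j, w i * (resistance p i j)⁻¹
        ≤ ∑ i ∈ Finset.Ico M j, (6 * (w i * (logGauge β i)⁻¹) +
            8 * C * w j * (((j : ℝ) - i)⁻¹ + (i : ℝ)⁻¹)) := by
          refine Finset.sum_le_sum fun i hi => ?_
          rw [Finset.mem_Ico] at hi
          exact hinv i j hi.1 hi.2
      _ ≤ 24 * S + 32 * C := by rw [Finset.sum_add_distrib]; linarith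
  have hsecond : ∑ i ∈ F, ∑ j ∈ F, w i * w j * (Q 0).real (strongCut i ∩ strongCut j) ≤
      (49 + 64 * C) * S ^ 2 := by
    set T : ℕ → ℕ → ℝ := fun i j => if i < j then w i * (resistance p i j)⁻¹ * (w j * b j) else 0
      with hT
    set D : ℕ → ℕ → ℝ := fun i j => if i = j then w i * b i else 0 with hD
    have h1 : ∀ i ∈ F, ∀ j ∈ F, w i * w j * (Q 0).real (strongCut i ∩ strongCut j) ≤
        T i j + T j i + D i j := by
      intro i hi j hj
      have hwi := hw0 i (Finset.mem_Ico.1 hi).1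
      have hwj := hw0 j (Finset.mem_Ico.1 hj).1
      simp only [hT, hD]
      rcases lt_trichotomy i j with h | h | h
      · rw [if_pos h, if_neg h.not_gt, if_neg h.ne]
        have := mul_le_mul_of_nonneg_left (hQ.real_strongCut_inter_le hp h)
          (mul_nonneg hwi.1.le hwj.1.le)
        linarith
      · subst h
        rw [if_neg (lt_irrefl i), if_pos rfl, Set.inter_self]
        have := mul_le_mul_of_nonneg_right hwi.2 (mul_nonneg hwi.1.le (hb0 i))
        change w i * w i * b i ≤ _
        linarith
      · rw [if_neg h.not_gt, if_pos h, if_neg h.ne', Set.inter_comm]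
        have := mul_le_mul_of_nonneg_left (hQ.real_strongCut_inter_le hp h)
          (mul_nonneg hwi.1.le hwj.1.le)
        linarith
    have h2 : ∑ j ∈ F, ∑ i ∈ F, T i j ≤ (24 * S + 32 * C) * S := by
      rw [hS, Finset.mul_sum]
      refine Finset.sum_le_sum fun j hj => ?_
      have hj' := Finset.mem_Ico.1 hj
      have e : ∑ i ∈ F, T i j =
          (∑ i ∈ Finset.Ico M j, w i * (resistance p i j)⁻¹) * (w j * b j) := by
        rw [Finset.sum_mul, ← Finset.sum_filter]
        refine Finset.sum_congr ?_ fun _ _ => rfl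
        ext i
        simp only [hF, Finset.mem_filter, Finset.mem_Ico]
        omega
      rw [e]
      exact mul_le_mul_of_nonneg_right (hinner j hj) (mul_nonneg (hw0 j hj'.1).1.le (hb0 j))
    have h3 : ∑ i ∈ F, ∑ j ∈ F, D i j = S := by
      rw [hS]
      refine Finset.sum_congr rfl fun i hi => ?_
      simp only [hD]
      rw [Finset.sum_ite_eq, if_pos hi]
    calc ∑ i ∈ F, ∑ j ∈ F, w i * w j * (Q 0).real (strongCut i ∩ strongCut j)
        ≤ ∑ i ∈ F, ∑ j ∈ F, (T i j + T j i + D i j) :=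
          Finset.sum_le_sum fun i hi => Finset.sum_le_sum fun j hj => h1 i hi j hj
      _ = ∑ j ∈ F, ∑ i ∈ F, T i j + ∑ j ∈ F, ∑ i ∈ F, T i j + S := by
          simp only [Finset.sum_add_distrib]
          rw [h3, Finset.sum_comm]
      _ ≤ (49 + 64 * C) * S ^ 2 := by
          have h4 : S ≤ S ^ 2 := by nlinarith
          have h5 := mul_le_mul_of_nonneg_left h4 hC0.le
          nlinarith
  have hCS := sq_sum_mul_real_le (Q 0) F measurableSet_strongCut w
  have hU0 : 0 ≤ (Q 0).real (⋃ m ∈ F, strongCut m) := measureReal_nonneg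
  have hfin := hCS.trans (mul_le_mul_of_nonneg_left hsecond hU0)
  change S ^ 2 ≤ _ at hfin
  have hS2 : 0 < S ^ 2 := by positivity
  rw [inv_eq_one_div, div_le_iff₀ (by positivity)]
  refine le_of_mul_le_mul_right ?_ hS2
  linarith

end IsWalkFamily

/-! ### Transfer to the given walk -/

theorem theorem5p1 {Ω : Type*} [MeasurableSpace Ω] (μ : Measure Ω) [IsProbabilityMeasure μ]
    (β : ℝ) (p : ℕ → ℝ)
    (hp : ∀ k : ℕ, 1 ≤ k → 0 ≤ p k ∧ p k < 1 / 2)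
    (hpβ : ∀ᶠ k : ℕ in atTop,
      p k = 1 / 4 * (1 / (k : ℝ) + 1 / ((k : ℝ) * Real.log (Real.log (k : ℝ)) ^ β)))
    (X : ℕ → Ω → ℕ) (hX : IsNNWalk μ p X) :
    (1 < β → ∀ᵐ ω ∂μ, (cutpoints fun n => X n ω).Finite) ∧
      (β ≤ 1 → ∀ᵐ ω ∂μ, (strongCutpoints fun n => X n ω).Infinite) := by
  obtain ⟨Q, hQ, hQ0⟩ := hX.exists_isWalkFamily hp
  obtain ⟨M, hg⟩ := exists_isGauge hp hpβ
  have hm : AEMeasurable (fun ω n => X n ω) μ :=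
    (measurable_pi_iff.2 hX.measurable).aemeasurable
  constructor
  · intro hβ
    have h := hQ.ae_finite_cutpoints hp (summable_sum_Ico_div hβ (fun _ => measureReal_nonneg)
      (hQ.eventually_real_stayAbove_le hp hg))
    rw [hQ0] at h
    exact ae_of_ae_map hm h
  · intro hβ
    obtain ⟨c, hc, hev⟩ := hQ.eventually_le_real_biUnion_strongCut hp hβ hg
    have h := hQ.ae_infinite_strongCutpoints hp hc hev
    rw [hQ0] at h
    exact ae_of_ae_map hm h
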